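/- For a real number $x$ let $\|x\|$ denote the distance from $x$ to the nearest integer. Let $\alpha$ be an irrational real number with continued fraction expansion $\alpha=[a_0;a_1,a_2,\ldots]$ and convergents $p_k/q_k=[a_0;a_1,\ldots,a_k]$, and let $s_K=\sum_{k=1}^K a_k$. Write $\log^* x=\log\max\{e,x\}$. There is a universal constant $C>0$ (independent of $\alpha$, $K$ and $N$) such that for every irrational $\alpha$, every integer $K\ge 0$ and every integer $N$ with $q_K\le N<q_{K+1}$, \[ \left| \sum_{n=1}^N \frac{1}{n\|n\alpha\|} - \left( (\log N)^2+\frac{\pi^2}{6}s_K+a_{K+1}\sum_{1\le j\le N/q_K}\frac{1}{j^2} \right) \right| \le C\left( \sum_{k=1}^{K+1} a_k^{1/2}\log^* a_k+(\log^* s_{K+1})\log^* N \right). \] -/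

import Mathlib

noncomputable section

/-- The distance `‖x‖` from the real number `x` to the nearest integer. -/
def distNearestInt (x : ℝ) : ℝ := |x - round x|

/-- The partial quotients `a_0, a_1, a_2, …` of the continued fraction
`α = [a_0; a_1, a_2, …]`, as real numbers. In Mathlib's expansion `a_0` is the head and `a_{k+1}` is
the `k`-th partial denominator. The expansion of an irrational number never terminates,
so the default value `0` is not used for irrational `α`. -/
def cfQuot (α : ℝ) : ℕ → ℝ
  | 0 => (GenContFract.of α).h
  | k + 1 => ((GenContFract.of α).partDens.get? k).getD 0

/-- The denominator `q_k` of the `k`-th convergent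
`p_k / q_k = [a_0; a_1, …, a_k]` of the continued fraction of `α`. -/
def cfDen (α : ℝ) (k : ℕ) : ℝ := (GenContFract.of α).dens k

/-- The sum `s_K = a_1 + ⋯ + a_K` of partial quotients. -/
def cfSum (α : ℝ) (K : ℕ) : ℝ := ∑ k ∈ Finset.Icc 1 K, cfQuot α k

/-- The logarithm as used in error terms: `log max {e, x}`. -/
def errLog (x : ℝ) : ℝ := Real.log (max (Real.exp 1) x)

end

/-! Cut `[1, N]` into blocks `q ≤ n < a * q + q'`, where `q'`, `q` are consecutive convergent
denominators and `a` is the next partial quotient, and truncate `1 / ‖nα‖` at height `2q` on each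
block.

Truncated part. By layer-cake summation, the truncation is, up to `2`, the number of `t ≤ 2q` with
`‖nα‖ < 1 / t`. These events have mean frequency `2 / t`, and their discrepancy is controlled by
sums of the sawtooth function: a full period of length `q` contributes at most `3` for every shift
(`abs_sum_saw_period`), so shorter sums are at most `3s`, with `s` the sum of partial quotients
(`abs_sum_saw_le`). Hence the truncated values sum to `2M log q + O((1 + log s) M)` over `n ≤ M`
(`abs_sum_min_sub`), and Abel summation with weights `1 / n` gives the increment of `log²` over the
block.

Excess. Only `n` with `‖nα‖ < 1 / (2q)` matter, and in the basis of the two convergents these are `n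
= uq` or `n = uq + q'` (`eq_of_dist_lt`). The first family gives `a ∑ 1 / u²`, the second only `O(1
+ log a)`.

Over the blocks the `log²` increments telescope, and each complete block gives `π² / 6` times its
partial quotient up to a bounded error. The block errors `(1 + log s)(1 + log ratio)` telescope too,
because the number of blocks is `O(log N)` by exponential growth of the denominators. The resulting
error is already `O(log* s_{K+1} log* N)`. -/

/-! ### Continued fractions of irrational numbers in terms of natural number recurrences -/

/-- The `n`-th complete quotient of `α`. -/
noncomputable def completeQuot (α : ℝ) (n : ℕ) : ℝ := (fun x : ℝ => (Int.fract x)⁻¹)^[n] α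

/-- The `n`-th partial quotient (for `1 ≤ n`) as a natural number. -/
noncomputable def quotNat (α : ℝ) (n : ℕ) : ℕ := ⌊completeQuot α n⌋₊

/-- Denominators of the convergents, with the index shifted by one. -/
noncomputable def denNat (α : ℝ) : ℕ → ℕ
  | 0 => 0
  | 1 => 1
  | n + 2 => quotNat α (n + 1) * denNat α (n + 1) + denNat α n

/-- Numerators of the convergents, with the index shifted by one. -/
noncomputable def numInt (α : ℝ) : ℕ → ℤ
  | 0 => 1
  | 1 => ⌊α⌋
  | n + 2 => quotNat α (n + 1) * numInt α (n + 1) + numInt α n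

/-- The absolute value of `q * α - p` for the convergents `p / q`, with the index shifted by one. -/
noncomputable def convErr (α : ℝ) : ℕ → ℝ
  | 0 => 1
  | n + 1 => convErr α n * Int.fract (completeQuot α n)

/-- Two consecutive convergents `p' / q'` and `p / q` of `α`, followed by the partial quotient `a`,
with signed errors `-σ * δ'` and `σ * δ`. -/
structure IsConvergentPair (α : ℝ) (q q' a : ℕ) (p p' σ : ℤ) (δ δ' : ℝ) : Prop where
  sign : σ = 1 ∨ σ = -1
  den_pos : 0 < q
  den_le : q' ≤ q
  quot_pos : 1 ≤ a
  err : q * α - p = σ * δ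
  err' : q' * α - p' = -(σ * δ')
  err_pos : 0 < δ
  lower : a * δ < δ'
  upper : δ' < (a + 1) * δ
  det : q * δ' + q' * δ = 1

theorem completeQuot_succ (α : ℝ) (n : ℕ) :
    completeQuot α (n + 1) = (Int.fract (completeQuot α n))⁻¹ := by
  simp only [completeQuot, Function.iterate_succ_apply']

theorem irrational_fract {x : ℝ} (h : Irrational x) : Irrational (Int.fract x) := by
  rw [Int.fract]; exact h.sub_intCast _

theorem irrational_completeQuot {α : ℝ} (h : Irrational α) (n : ℕ) :
    Irrational (completeQuot α n) := by
  induction n with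
  | zero => exact h
  | succ n ih =>
    rw [completeQuot_succ]
    exact (irrational_fract ih).inv

theorem fract_pos_of_irrational {x : ℝ} (h : Irrational x) : 0 < Int.fract x :=
  lt_of_le_of_ne (Int.fract_nonneg x) (fun h0 => (irrational_fract h).ne_zero h0.symm)

theorem one_lt_completeQuot {α : ℝ} (h : Irrational α) (n : ℕ) : 1 < completeQuot α (n + 1) := by
  rw [completeQuot_succ]
  exact (one_lt_inv₀ (fract_pos_of_irrational (irrational_completeQuot h n))).2
    (Int.fract_lt_one _)

theorem quotNat_pos {α : ℝ} (h : Irrational α) (n : ℕ) : 1 ≤ quotNat α (n + 1) := by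
  rw [quotNat, Nat.one_le_floor_iff]
  exact (one_lt_completeQuot h n).le

theorem completeQuot_eq {α : ℝ} (h : Irrational α) (n : ℕ) :
    completeQuot α (n + 1) = quotNat α (n + 1) + Int.fract (completeQuot α (n + 1)) := by
  have h0 : (0 : ℝ) ≤ completeQuot α (n + 1) := (zero_lt_one.trans (one_lt_completeQuot h n)).le
  have := Int.floor_add_fract (completeQuot α (n + 1))
  rw [quotNat, natCast_floor_eq_intCast_floor h0, this]

/-- Induction over all `α` at once: the tail of the expansion of `α` is the expansion of `(Int.fract
α)⁻¹`, the same shift that defines `completeQuot`. -/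
theorem of_s_get {α : ℝ} (h : Irrational α) (n : ℕ) :
    (GenContFract.of α).s.get? n = some ⟨1, (quotNat α (n + 1) : ℝ)⟩ := by
  induction n generalizing α with
  | zero =>
    have h1 := GenContFract.of_s_head (v := α) (fract_pos_of_irrational h).ne'
    rw [Stream'.Seq.head] at h1
    rw [h1, quotNat, natCast_floor_eq_intCast_floor (zero_lt_one.trans (one_lt_completeQuot h 0)).le]
    rfl
  | succ n ih =>
    rw [GenContFract.of_s_succ, ih (irrational_fract h).inv]
    rfl

theorem cfQuot_succ {α : ℝ} (h : Irrational α) (n : ℕ) :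
    cfQuot α (n + 1) = quotNat α (n + 1) := by
  rw [cfQuot, GenContFract.partDen_eq_s_b (of_s_get h n)]
  rfl

theorem contsAux_b {α : ℝ} (h : Irrational α) (n : ℕ) :
    ((GenContFract.of α).contsAux n).b = denNat α n ∧
      ((GenContFract.of α).contsAux (n + 1)).b = denNat α (n + 1) := by
  induction n with
  | zero => simp [denNat]
  | succ n ih =>
    refine ⟨ih.2, ?_⟩
    rw [GenContFract.contsAux_recurrence (of_s_get h n) rfl rfl]
    simp only [ih.1, ih.2, denNat]
    push_cast
    ring

theorem cfDen_eq {α : ℝ} (h : Irrational α) (k : ℕ) : cfDen α k = denNat α (k + 1) := by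
  rw [cfDen, GenContFract.den_eq_conts_b, GenContFract.nth_cont_eq_succ_nth_contAux]
  exact (contsAux_b h k).2

theorem convErr_pos {α : ℝ} (h : Irrational α) (n : ℕ) : 0 < convErr α n := by
  induction n with
  | zero => simp [convErr]
  | succ n ih => exact mul_pos ih (fract_pos_of_irrational (irrational_completeQuot h n))

theorem convErr_rec {α : ℝ} (h : Irrational α) (n : ℕ) :
    convErr α n = quotNat α (n + 1) * convErr α (n + 1) + convErr α (n + 2) := by
  have h1 := completeQuot_eq h n
  have h2 := completeQuot_succ α n
  have h3 := fract_pos_of_irrational (irrational_completeQuot h n)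
  simp only [convErr]
  have h4 : Int.fract (completeQuot α n) * completeQuot α (n + 1) = 1 := by
    rw [h2]; exact mul_inv_cancel₀ h3.ne'
  linear_combination (-convErr α n) * h4 + convErr α n * Int.fract (completeQuot α n) * h1

theorem convErr_succ_lt {α : ℝ} (h : Irrational α) (n : ℕ) : convErr α (n + 1) < convErr α n :=
  mul_lt_of_lt_one_right (convErr_pos h n) (Int.fract_lt_one _)

theorem den_mul_sub_num {α : ℝ} (h : Irrational α) (n : ℕ) :
    ((denNat α n : ℝ) * α - numInt α n = -((-1) ^ n * convErr α n)) ∧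
      ((denNat α (n + 1) : ℝ) * α - numInt α (n + 1) = (-1) ^ n * convErr α (n + 1)) := by
  induction n with
  | zero => simp [denNat, numInt, convErr, completeQuot]
  | succ n ih =>
    refine ⟨?_, ?_⟩
    · rw [ih.2]; ring
    · have h1 := convErr_rec h n
      simp only [denNat, numInt]
      push_cast
      linear_combination ih.1 + (quotNat α (n + 1) : ℝ) * ih.2 - (-1) ^ n * h1

theorem den_det {α : ℝ} (h : Irrational α) (n : ℕ) :
    (denNat α (n + 1) : ℝ) * convErr α n + denNat α n * convErr α (n + 1) = 1 := by
  induction n with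
  | zero => simp [denNat, convErr]
  | succ n ih =>
    have h1 := convErr_rec h n
    simp only [denNat]
    push_cast
    linear_combination ih - (denNat α (n + 1) : ℝ) * h1

theorem den_mono_pos {α : ℝ} (h : Irrational α) (n : ℕ) :
    denNat α n ≤ denNat α (n + 1) ∧ 0 < denNat α (n + 1) := by
  induction n with
  | zero => simp [denNat]
  | succ n ih =>
    have h1 := quotNat_pos h n
    have h2 : denNat α (n + 1) ≤ denNat α (n + 2) := by
      simp only [denNat]
      nlinarith [ih.2]
    exact ⟨h2, lt_of_lt_of_le ih.2 h2⟩

/-- Each denominator is at least twice the one two places earlier, so the product of two neighbours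
doubles at every step; using the product avoids a parity split. -/
theorem two_pow_le_den_sq {α : ℝ} (h : Irrational α) (n : ℕ) :
    2 ^ n ≤ denNat α (n + 1) * denNat α (n + 2) := by
  induction n with
  | zero =>
    have := (den_mono_pos h 0).2
    have := (den_mono_pos h 1).2
    simp only [pow_zero]
    exact Nat.mul_pos ‹_› ‹_›
  | succ n ih =>
    have h1 := quotNat_pos h (n + 1)
    have h2 := (den_mono_pos h (n + 1)).1
    have h3 : 2 * denNat α (n + 1) ≤ denNat α (n + 3) := by
      have : denNat α (n + 3) =
        quotNat α (n + 2) * denNat α (n + 2) + denNat α (n + 1) := rfl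
      rw [this]
      nlinarith
    calc 2 ^ (n + 1) = 2 * 2 ^ n := by ring
      _ ≤ 2 * (denNat α (n + 1) * denNat α (n + 2)) := by gcongr
      _ = denNat α (n + 2) * (2 * denNat α (n + 1)) := by ring
      _ ≤ _ := by gcongr

theorem isConvergentPair {α : ℝ} (h : Irrational α) (k : ℕ) :
    IsConvergentPair α (denNat α (k + 1)) (denNat α k) (quotNat α (k + 1)) (numInt α (k + 1))
      (numInt α k) ((-1) ^ k) (convErr α (k + 1)) (convErr α k) where
  sign := neg_one_pow_eq_or ℤ k
  den_pos := (den_mono_pos h k).2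
  den_le := (den_mono_pos h k).1
  quot_pos := quotNat_pos h k
  err := by rw [(den_mul_sub_num h k).2]; push_cast; ring
  err' := by rw [(den_mul_sub_num h k).1]; push_cast; ring
  err_pos := convErr_pos h _
  lower := by
    have := convErr_rec h k
    linarith [convErr_pos h (k + 2)]
  upper := by
    have := convErr_rec h k
    linarith [convErr_succ_lt h (k + 1)]
  det := den_det h k

namespace IsConvergentPair

variable {α : ℝ} {q q' a : ℕ} {p p' σ : ℤ} {δ δ' : ℝ}

theorem sign_mul_self (H : IsConvergentPair α q q' a p p' σ δ δ') : σ * σ = 1 := by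
  rcases H.sign with h | h <;> simp [h]

theorem abs_sign (H : IsConvergentPair α q q' a p p' σ δ δ') : |(σ : ℝ)| = 1 := by
  rcases H.sign with h | h <;> simp [h]

/-- Eliminating `α` from the two error identities turns `det` into a statement about integers. It
makes `(q, p)`, `(q', p')` a basis of `ℤ²` and gives the coprimality of `p` and `q`. -/
theorem int_det (H : IsConvergentPair α q q' a p p' σ δ δ') : q * p' - q' * p = σ := by
  have : ((q * p' - q' * p : ℤ) : ℝ) = σ := by
    push_cast
    linear_combination (q' : ℝ) * H.err - (q : ℝ) * H.err' + σ * H.det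
  exact_mod_cast this

theorem err_lt (H : IsConvergentPair α q q' a p p' σ δ δ') : δ < δ' := by
  have h1 : (1 : ℝ) ≤ a := by exact_mod_cast H.quot_pos
  nlinarith [H.lower, H.err_pos]

theorem mul_err_le_one (H : IsConvergentPair α q q' a p p' σ δ δ') : q * δ ≤ 1 := by
  have h1 := H.det
  have h2 := H.err_lt
  have h3 : (0 : ℝ) < q := by exact_mod_cast H.den_pos
  have h4 : (0 : ℝ) ≤ q' := by positivity
  nlinarith [H.err_pos, mul_nonneg h4 H.err_pos.le]

theorem abs_err (H : IsConvergentPair α q q' a p p' σ δ δ') : |(q : ℝ) * α - p| = δ := by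
  rw [H.err, abs_mul, H.abs_sign, abs_of_pos H.err_pos, one_mul]

/-- The quantity `1 / (q * δ)` lies between `a` and `a + 2`. -/
theorem one_le_mul (H : IsConvergentPair α q q' a p p' σ δ δ') : a * (q * δ) ≤ 1 := by
  have h3 : (0 : ℝ) < q := by exact_mod_cast H.den_pos
  have h4 : (0 : ℝ) ≤ q' := by positivity
  nlinarith [H.det, H.lower, mul_nonneg h4 H.err_pos.le]

theorem le_add_two_mul (H : IsConvergentPair α q q' a p p' σ δ δ') : 1 ≤ (a + 2) * (q * δ) := by
  have h3 : (0 : ℝ) < q := by exact_mod_cast H.den_pos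
  have h4 : (q' : ℝ) ≤ q := by exact_mod_cast H.den_le
  nlinarith [H.det, H.upper, mul_le_mul_of_nonneg_right h4 H.err_pos.le,
    mul_lt_mul_of_pos_left H.upper h3]

theorem one_le_two_mul (H : IsConvergentPair α q q' a p p' σ δ δ') : 1 ≤ 2 * q * δ' := by
  have h3 : (0 : ℝ) < q := by exact_mod_cast H.den_pos
  have h4 : (q' : ℝ) ≤ q := by exact_mod_cast H.den_le
  nlinarith [H.det, H.err_lt, mul_le_mul_of_nonneg_right h4 H.err_pos.le,
    mul_lt_mul_of_pos_left H.err_lt h3]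

end IsConvergentPair

/-! ### Sums of the sawtooth function along multiples of `α` -/

/-- The sawtooth function. -/
noncomputable def saw (x : ℝ) : ℝ := Int.fract x - 1 / 2

theorem fract_int_add_div {q : ℕ} (hq : 0 < q) (k : ℤ) {θ : ℝ} (h0 : 0 ≤ θ) (h1 : θ < 1) :
    Int.fract ((k + θ) / q) = (((k % q : ℤ) : ℝ) + θ) / q := by
  have hq' : (0 : ℝ) < q := by exact_mod_cast hq
  have hqz : (0 : ℤ) < q := by exact_mod_cast hq
  rw [Int.fract_eq_iff]
  have hm0 : (0 : ℝ) ≤ ((k % q : ℤ) : ℝ) := by exact_mod_cast Int.emod_nonneg k hqz.ne'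
  have hm1 : ((k % q : ℤ) : ℝ) + 1 ≤ q := by exact_mod_cast Int.emod_lt_of_pos k hqz
  refine ⟨by positivity, ?_, k / q, ?_⟩
  · rw [div_lt_one hq']; linarith
  · have : (k : ℝ) = ((k % q : ℤ) : ℝ) + q * ((k / q : ℤ) : ℝ) := by
      exact_mod_cast (Int.emod_add_mul_ediv k q).symm
    rw [← sub_div, div_eq_iff hq'.ne']
    linear_combination this

/-- Multiplication by a unit followed by a translation permutes the residues modulo `q`. -/
theorem sum_range_emod_linear {q : ℕ} (hq : 0 < q) {p : ℤ} (hp : IsCoprime p (q : ℤ)) (m : ℤ) :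
    ∑ n ∈ Finset.range q, (n * p + m) % (q : ℤ) = ∑ n ∈ Finset.range q, (n : ℤ) := by
  have hqz : (0 : ℤ) < q := by exact_mod_cast hq
  have key : ∀ n : ℕ, 0 ≤ (n * p + m) % (q : ℤ) ∧ (n * p + m) % (q : ℤ) < q := fun n =>
    ⟨Int.emod_nonneg _ hqz.ne', Int.emod_lt_of_pos _ hqz⟩
  have hmaps : ∀ n ∈ Finset.range q, ((n * p + m) % (q : ℤ)).toNat ∈ Finset.range q := by
    intro n _
    have := key n
    simp only [Finset.mem_range]
    omega
  have hinj : Set.InjOn (fun n : ℕ => ((n * p + m) % (q : ℤ)).toNat) (Finset.range q) := by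
    intro i hi j hj hij
    simp only [Finset.coe_range, Set.mem_Iio] at hi hj
    have hi' := key i
    have hj' := key j
    have h1 : (i * p + m) % (q : ℤ) = (j * p + m) % (q : ℤ) := by
      simp only at hij
      omega
    have h2 : (q : ℤ) ∣ ((i : ℤ) - j) * p := by
      have := Int.ModEq.dvd (Int.ModEq.symm h1)
      have e : (i * p + m : ℤ) - (j * p + m) = ((i : ℤ) - j) * p := by ring
      rwa [e] at this
    have h3 : (q : ℤ) ∣ (i : ℤ) - j := hp.symm.dvd_of_dvd_mul_right h2
    have h4 : ((i : ℤ) - j) = 0 := by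
      apply Int.eq_zero_of_abs_lt_dvd h3
      rw [abs_lt]; omega
    omega
  have himg : (Finset.range q).image (fun n : ℕ => ((n * p + m) % (q : ℤ)).toNat)
      = Finset.range q := by
    apply Finset.eq_of_subset_of_card_le
    · intro x hx
      obtain ⟨n, hn, rfl⟩ := Finset.mem_image.1 hx
      exact hmaps n hn
    · rw [Finset.card_image_of_injOn hinj]
  conv_rhs => rw [← himg]
  rw [Finset.sum_image hinj]
  refine Finset.sum_congr rfl fun n _ => ?_
  rw [Int.toNat_of_nonneg (key n).1]

theorem sum_fract_rational {q : ℕ} (hq : 0 < q) {p : ℤ} (hp : IsCoprime p (q : ℤ)) (x : ℝ) :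
    ∑ n ∈ Finset.range q, Int.fract ((n : ℝ) * p / q + x) =
      ((q : ℝ) - 1) / 2 + Int.fract (q * x) := by
  have hq' : (0 : ℝ) < q := by exact_mod_cast hq
  have h1 : ∀ n ∈ Finset.range q, Int.fract ((n : ℝ) * p / q + x) =
      ((((n * p + ⌊q * x⌋) % (q : ℤ) : ℤ) : ℝ) + Int.fract (q * x)) / q := by
    intro n _
    rw [← fract_int_add_div hq _ (Int.fract_nonneg _) (Int.fract_lt_one _)]
    congr 1
    have := Int.floor_add_fract ((q : ℝ) * x)
    push_cast
    field_simp
    linear_combination -this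
  rw [Finset.sum_congr rfl h1, ← Finset.sum_div, Finset.sum_add_distrib, ← Int.cast_sum,
    sum_range_emod_linear hq hp]
  have h2 : (((∑ n ∈ Finset.range q, (n : ℤ) : ℤ) : ℝ)) = q * (q - 1) / 2 := by
    have := Finset.sum_range_id_mul_two q
    have h3 : ((∑ n ∈ Finset.range q, n : ℕ) : ℝ) * 2 = q * (q - 1) := by
      rw [← Nat.cast_pred hq]
      exact_mod_cast this
    push_cast at h3 ⊢
    linarith
  rw [h2, Finset.sum_const, Finset.card_range, nsmul_eq_mul]
  field_simp

theorem sum_floor_rational {q : ℕ} (hq : 0 < q) {p : ℤ} (hp : IsCoprime p (q : ℤ)) (x : ℝ) :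
    ∑ n ∈ Finset.range q, (⌊(n : ℝ) * p / q + x⌋ : ℝ) =
      (∑ n ∈ Finset.range q, (n : ℝ) * p / q) - ((q : ℝ) - 1) / 2 + ⌊q * x⌋ := by
  have h := sum_fract_rational hq hp x
  simp only [Int.fract] at h
  rw [Finset.sum_sub_distrib, Finset.sum_add_distrib, Finset.sum_const, Finset.card_range,
    nsmul_eq_mul] at h
  linarith

/-- For `n < q` the points `nα` and `np / q` differ by at most `1 / q`. Since the floor is monotone,
the floor sum lies between the rational floor sums at `x - 1 / q` and `x + 1 / q`, which are known
exactly and differ by only `2`. -/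
theorem abs_sum_saw_period {α : ℝ} {q : ℕ} (hq : 0 < q) {p : ℤ} (hp : IsCoprime p (q : ℤ))
    (happ : |(q : ℝ) * α - p| * q ≤ 1) (x : ℝ) :
    |∑ n ∈ Finset.range q, saw (n * α + x)| ≤ 3 := by
  have hq' : (0 : ℝ) < q := by exact_mod_cast hq
  set e := |(q : ℝ) * α - p| with he
  have e0 : 0 ≤ e := abs_nonneg _
  have hdiff : ∀ n ∈ Finset.range q, |(n : ℝ) * α - n * p / q| ≤ 1 / q := by
    intro n hn
    have hn' : (n : ℝ) ≤ q := by exact_mod_cast (Finset.mem_range.1 hn).le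
    have : (n : ℝ) * α - n * p / q = n / q * (q * α - p) := by field_simp
    rw [this, abs_mul, abs_of_nonneg (by positivity), ← he, div_mul_eq_mul_div]
    gcongr
    nlinarith
  have hfl : ∀ y : ℝ, ∑ n ∈ Finset.range q, (⌊(n : ℝ) * p / q + y⌋ : ℝ) =
      (∑ n ∈ Finset.range q, (n : ℝ) * p / q) - ((q : ℝ) - 1) / 2 + ⌊q * y⌋ :=
    sum_floor_rational hq hp
  have hlow : ∑ n ∈ Finset.range q, (⌊(n : ℝ) * p / q + (x - 1 / q)⌋ : ℝ) ≤
      ∑ n ∈ Finset.range q, (⌊(n : ℝ) * α + x⌋ : ℝ) := by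
    refine Finset.sum_le_sum fun n hn => ?_
    have := abs_le.1 (hdiff n hn)
    exact Int.cast_le.2 (Int.floor_le_floor (by linarith))
  have hup : ∑ n ∈ Finset.range q, (⌊(n : ℝ) * α + x⌋ : ℝ) ≤
      ∑ n ∈ Finset.range q, (⌊(n : ℝ) * p / q + (x + 1 / q)⌋ : ℝ) := by
    refine Finset.sum_le_sum fun n hn => ?_
    have := abs_le.1 (hdiff n hn)
    exact Int.cast_le.2 (Int.floor_le_floor (by linarith))
  rw [hfl] at hlow hup
  have e1 : (q : ℝ) * (x - 1 / q) = q * x - 1 := by field_simp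
  have e2 : (q : ℝ) * (x + 1 / q) = q * x + 1 := by field_simp
  rw [e1, Int.floor_sub_one] at hlow
  rw [e2, Int.floor_add_one] at hup
  push_cast at hlow hup
  have hlin : |(∑ n ∈ Finset.range q, (n : ℝ) * α) - ∑ n ∈ Finset.range q, (n : ℝ) * p / q| ≤ 1 := by
    rw [← Finset.sum_sub_distrib]
    refine (Finset.abs_sum_le_sum_abs _ _).trans ((Finset.sum_le_sum hdiff).trans ?_)
    rw [Finset.sum_const, Finset.card_range, nsmul_eq_mul]
    field_simp
    exact le_refl _
  have hs : ∑ n ∈ Finset.range q, saw (n * α + x) = (∑ n ∈ Finset.range q, (n : ℝ) * α) + q * x -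
      (∑ n ∈ Finset.range q, (⌊(n : ℝ) * α + x⌋ : ℝ)) - q / 2 := by
    simp only [saw, Int.fract, Finset.sum_sub_distrib, Finset.sum_add_distrib, Finset.sum_const,
      Finset.card_range, nsmul_eq_mul]
    ring
  have hlin' := abs_le.1 hlin
  have f1 := Int.floor_le ((q : ℝ) * x)
  have f2 := Int.lt_floor_add_one ((q : ℝ) * x)
  rw [hs, abs_le]
  constructor <;> linarith

theorem sum_saw_add (α x : ℝ) (L M : ℕ) :
    ∑ n ∈ Finset.range (L + M), saw (n * α + x) =
      ∑ n ∈ Finset.range L, saw (n * α + x) +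
        ∑ n ∈ Finset.range M, saw (n * α + (L * α + x)) := by
  rw [Finset.sum_range_add]
  congr 1
  refine Finset.sum_congr rfl fun n _ => ?_
  congr 1
  push_cast
  ring

/-- Cutting off a period shifts the argument by `q * α`, which is why all bounds are uniform in `x`.
-/
theorem abs_sum_saw_mul_add {α B : ℝ} {q : ℕ}
    (hB : ∀ x, |∑ n ∈ Finset.range q, saw (n * α + x)| ≤ B) {M : ℕ} {B' : ℝ}
    (hB' : ∀ x, |∑ n ∈ Finset.range M, saw (n * α + x)| ≤ B') (j : ℕ) (x : ℝ) :
    |∑ n ∈ Finset.range (j * q + M), saw (n * α + x)| ≤ j * B + B' := by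
  induction j generalizing x with
  | zero => simpa using hB' x
  | succ j ih =>
    have : (j + 1) * q + M = q + (j * q + M) := by ring
    rw [this, sum_saw_add]
    refine (abs_add_le _ _).trans ?_
    push_cast
    linarith [hB x, ih (q * α + x)]

theorem IsConvergentPair.abs_sum_saw {α : ℝ} {q q' a : ℕ} {p p' σ : ℤ} {δ δ' : ℝ}
    (H : IsConvergentPair α q q' a p p' σ δ δ') (x : ℝ) :
    |∑ n ∈ Finset.range q, saw (n * α + x)| ≤ 3 := by
  refine abs_sum_saw_period H.den_pos (p := p) ⟨-σ * q', σ * p', ?_⟩ ?_ x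
  · linear_combination σ * H.int_det + H.sign_mul_self
  · rw [H.abs_err, mul_comm]; exact H.mul_err_le_one

theorem cfSum_succ {α : ℝ} (h : Irrational α) (k : ℕ) :
    cfSum α (k + 1) = cfSum α k + quotNat α (k + 1) := by
  rw [cfSum, cfSum, Finset.sum_Icc_succ_top (by omega), cfQuot_succ h]

theorem abs_sum_saw_le {α : ℝ} (h : Irrational α) (k : ℕ) {M : ℕ} (hM : M < denNat α (k + 1))
    (x : ℝ) : |∑ n ∈ Finset.range M, saw (n * α + x)| ≤ 3 * cfSum α k := by
  induction k generalizing M x with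
  | zero =>
    have : M = 0 := by simpa [denNat] using hM
    simp [this, cfSum]
  | succ k ih =>
    have H := isConvergentPair h k
    set q := denNat α (k + 1)
    have hdm := Nat.div_add_mod M q
    have hmod : M % q < q := Nat.mod_lt _ H.den_pos
    -- `M < a * q + q' ≤ (a + 1) * q`, so at most `a` full periods are cut off; the remainder is
    -- below `q` and falls to the induction hypothesis.
    have hj : M / q ≤ quotNat α (k + 1) := by
      have h1 : M < quotNat α (k + 1) * q + denNat α k := hM
      have h2 := H.den_le
      rw [← Nat.lt_succ_iff, Nat.div_lt_iff_lt_mul H.den_pos, Nat.succ_mul]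
      omega
    have h1 := abs_sum_saw_mul_add H.abs_sum_saw (fun y => ih hmod y) (M / q) x
    rw [mul_comm, hdm] at h1
    have h2 : ((M / q : ℕ) : ℝ) ≤ quotNat α (k + 1) := by exact_mod_cast hj
    rw [cfSum_succ h]
    linarith

/-! ### Counting multiples of `α` close to integers -/

theorem distNearestInt_le_half (y : ℝ) : distNearestInt y ≤ 1 / 2 := abs_sub_round y

theorem distNearestInt_pos {y : ℝ} (hy : Irrational y) : 0 < distNearestInt y :=
  abs_pos.2 (sub_ne_zero.2 (hy.ne_int _))

theorem distNearestInt_le (y : ℝ) (m : ℤ) : distNearestInt y ≤ |y - m| := round_le y m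

theorem irrational_natCast_mul {α : ℝ} (h : Irrational α) {n : ℕ} (hn : 0 < n) :
    Irrational ((n : ℝ) * α) := h.natCast_mul hn.ne'

/-- The indicator of `‖y‖ < 1 / t`. -/
noncomputable def nearInd (y : ℝ) (t : ℕ) : ℝ := if distNearestInt y < 1 / t then 1 else 0

theorem nearInd_nonneg (y : ℝ) (t : ℕ) : 0 ≤ nearInd y t := by
  unfold nearInd; split_ifs <;> norm_num

/-- The right side collapses to `⌊y + 1/t⌋ - ⌊y - 1/t⌋`, the number of integers in an interval of
length `2 / t ≤ 1` around `y`. Irrationality keeps its endpoints off the integers. -/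
theorem nearInd_eq_saw {y : ℝ} (hy : Irrational y) {t : ℕ} (ht : 2 ≤ t) :
    nearInd y t = 2 / t - saw (y + 1 / t) + saw (y - 1 / t) := by
  have ht' : (2 : ℝ) ≤ t := by exact_mod_cast ht
  have hρ : (0 : ℝ) < 1 / t := by positivity
  have hρ2 : (1 : ℝ) / t ≤ 1 / 2 := one_div_le_one_div_of_le (by norm_num) ht'
  set ρ : ℝ := 1 / t with hρdef
  set m : ℤ := round y with hm
  have hd : distNearestInt y = |y - m| := rfl
  have hhalf : |y - m| ≤ 1 / 2 := abs_sub_round y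
  have hne : |y - m| ≠ ρ := by
    intro h
    have hr : y = m + ρ ∨ y = m - ρ := by
      rcases abs_eq hρ.le |>.1 h with h | h
      · left; linarith
      · right; linarith
    rcases hr with h | h
    · exact hy ⟨m + 1 / t, by rw [h, hρdef]; push_cast; ring⟩
    · exact hy ⟨m - 1 / t, by rw [h, hρdef]; push_cast; ring⟩
  have e : (2 : ℝ) / t - saw (y + ρ) + saw (y - ρ) = ⌊y + ρ⌋ - ⌊y - ρ⌋ := by
    simp only [saw, Int.fract]
    rw [show (2 : ℝ) / t = 2 * ρ by rw [hρdef]; ring]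
    ring
  rw [e, nearInd, hd]
  have hab := abs_le.1 hhalf
  split_ifs with h
  · have h' := abs_lt.1 h
    have f1 : ⌊y + ρ⌋ = m := Int.floor_eq_iff.2 ⟨by linarith, by linarith⟩
    have f2 : ⌊y - ρ⌋ = m - 1 :=
      Int.floor_eq_iff.2 ⟨by push_cast; linarith, by push_cast; linarith⟩
    rw [f1, f2]; push_cast; ring
  · have h' : ρ < |y - m| := lt_of_le_of_ne (not_lt.1 h) hne.symm
    rcases lt_abs.1 h' with h' | h'
    · have f1 : ⌊y + ρ⌋ = m := Int.floor_eq_iff.2 ⟨by linarith, by linarith⟩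
      have f2 : ⌊y - ρ⌋ = m := Int.floor_eq_iff.2 ⟨by linarith, by linarith⟩
      rw [f1, f2]; ring
    · have f1 : ⌊y + ρ⌋ = m - 1 :=
        Int.floor_eq_iff.2 ⟨by push_cast; linarith, by push_cast; linarith⟩
      have f2 : ⌊y - ρ⌋ = m - 1 :=
        Int.floor_eq_iff.2 ⟨by push_cast; linarith, by push_cast; linarith⟩
      rw [f1, f2]; ring

/-- Truncating `1 / ‖y‖` at height `Q` is counting the `t ≤ Q` with `‖y‖ < 1 / t`, up to `2`. -/
theorem abs_min_sub_sum_nearInd {y : ℝ} (hy : Irrational y) {Q : ℕ} (hQ : 1 ≤ Q) :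
    |min (1 / distNearestInt y) Q - ∑ t ∈ Finset.Icc 2 Q, nearInd y t| ≤ 2 := by
  have hd0 := distNearestInt_pos hy
  set D := 1 / distNearestInt y with hD
  have hD2 : 2 ≤ D := by
    rw [hD, le_div_iff₀ hd0]
    linarith [distNearestInt_le_half y]
  have hind : ∀ t : ℕ, 1 ≤ t → nearInd y t = if (t : ℝ) < D then 1 else 0 := by
    intro t ht
    have ht' : (0 : ℝ) < t := by exact_mod_cast ht
    have : distNearestInt y < 1 / t ↔ (t : ℝ) < D := by
      rw [hD, lt_div_iff₀ ht', lt_div_iff₀ hd0, mul_comm]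
    simp only [nearInd, this]
  -- The integers `t` with `2 ≤ t ≤ Q` and `t < D` number `Q - 1` if `Q < D`, and `⌈D⌉ - 2`
  -- otherwise.
  have key : ((Q : ℝ) < D → ∑ t ∈ Finset.Icc 2 Q, nearInd y t = Q - 1) ∧
      (D ≤ Q → D - 2 ≤ ∑ t ∈ Finset.Icc 2 Q, nearInd y t ∧
        ∑ t ∈ Finset.Icc 2 Q, nearInd y t ≤ D - 1) := by
    induction Q, hQ using Nat.le_induction with
    | base =>
      simp only [Finset.Icc_eq_empty_of_lt (show 1 < 2 by norm_num), Finset.sum_empty]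
      push_cast
      exact ⟨fun _ => by norm_num, fun h => by linarith⟩
    | succ Q hQ ih =>
      rw [Finset.sum_Icc_succ_top (by omega), hind (Q + 1) (by omega)]
      push_cast
      refine ⟨fun h => ?_, fun h => ?_⟩
      · rw [if_pos h, ih.1 (by linarith)]; ring
      · rw [if_neg (not_lt.2 h), add_zero]
        rcases lt_or_ge (Q : ℝ) D with h' | h'
        · rw [ih.1 h']; constructor <;> linarith
        · exact ih.2 h'
  rcases lt_or_ge (Q : ℝ) D with h | h
  · rw [key.1 h, min_eq_right h.le]
    norm_num
  · have := key.2 h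
    rw [min_eq_left h, abs_le]
    constructor <;> linarith

theorem abs_sum_nearInd_sub {α : ℝ} (h : Irrational α) {M : ℕ} {B : ℝ}
    (hB : ∀ x, |∑ n ∈ Finset.range M, saw (n * α + x)| ≤ B) {t : ℕ} (ht : 2 ≤ t) :
    |∑ n ∈ Finset.range M, nearInd (((n + 1 : ℕ) : ℝ) * α) t - 2 * M / t| ≤ 2 * B := by
  have e : ∀ n ∈ Finset.range M, nearInd (((n + 1 : ℕ) : ℝ) * α) t =
      2 / t - saw (n * α + (α + 1 / t)) + saw (n * α + (α - 1 / t)) := by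
    intro n _
    rw [nearInd_eq_saw (irrational_natCast_mul h n.succ_pos) ht]
    have e1 : ((n + 1 : ℕ) : ℝ) * α + 1 / t = n * α + (α + 1 / t) := by push_cast; ring
    have e2 : ((n + 1 : ℕ) : ℝ) * α - 1 / t = n * α + (α - 1 / t) := by push_cast; ring
    rw [e1, e2]
  rw [Finset.sum_congr rfl e, Finset.sum_add_distrib, Finset.sum_sub_distrib, Finset.sum_const,
    Finset.card_range, nsmul_eq_mul]
  have h1 := abs_le.1 (hB (α + 1 / t))
  have h2 := abs_le.1 (hB (α - 1 / t))
  have e2 : (M : ℝ) * (2 / t) = 2 * M / t := by ring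
  rw [e2, abs_le]
  constructor <;> linarith

/-- Enlarging the range to whole periods, `j * q ≤ 2 * M`, replaces the discrepancy by `3` per
period. The factor two lost in the main term is affordable for large `t`, where the bound by `s` is
too costly. -/
theorem sum_nearInd_le {α : ℝ} {q q' a : ℕ} {p p' σ : ℤ} {δ δ' : ℝ} (h : Irrational α)
    (H : IsConvergentPair α q q' a p p' σ δ δ') {M : ℕ} (hM : q ≤ M) {t : ℕ} (ht : 2 ≤ t) :
    ∑ n ∈ Finset.range M, nearInd (((n + 1 : ℕ) : ℝ) * α) t ≤ 4 * M / t + 12 * M / q := by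
  have hq : (0 : ℝ) < q := by exact_mod_cast H.den_pos
  have ht' : (0 : ℝ) < t := by positivity
  set j := M / q + 1 with hj
  have hMj : M ≤ j * q + 0 := by
    have h1 := Nat.div_add_mod M q
    have h2 := Nat.mod_lt M H.den_pos
    rw [hj]; nlinarith
  have hj2 : ((j : ℕ) : ℝ) * q ≤ 2 * M := by
    have h1 : M / q * q ≤ M := Nat.div_mul_le_self M q
    have : j * q ≤ 2 * M := by rw [hj]; nlinarith
    exact_mod_cast this
  have hB : ∀ x, |∑ n ∈ Finset.range (j * q + 0), saw (n * α + x)| ≤ j * 3 + 0 :=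
    abs_sum_saw_mul_add H.abs_sum_saw (by simp) j
  have h1 := (abs_le.1 (abs_sum_nearInd_sub h hB ht)).2
  have h2 : ∑ n ∈ Finset.range M, nearInd (((n + 1 : ℕ) : ℝ) * α) t ≤
      ∑ n ∈ Finset.range (j * q + 0), nearInd (((n + 1 : ℕ) : ℝ) * α) t :=
    Finset.sum_le_sum_of_subset_of_nonneg (Finset.range_subset_range.2 hMj)
      fun n _ _ => nearInd_nonneg _ _
  have h3 : (2 : ℝ) * ((j * q + 0 : ℕ) : ℝ) / t ≤ 4 * M / t := by
    push_cast
    gcongr ?_ / _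
    linarith
  have h4 : (6 : ℝ) * j ≤ 12 * M / q := by
    rw [le_div_iff₀ hq]; linarith
  linarith

/-! ### Harmonic sums and the mean of the truncated values -/

theorem sum_one_div_le (n : ℕ) :
    ∑ i ∈ Finset.Icc 1 n, 1 / (i : ℝ) ≤ 1 + Real.log n := by
  have := harmonic_le_one_add_log n
  rw [harmonic_eq_sum_Icc] at this
  push_cast at this
  simpa only [one_div] using this

theorem log_add_one_le_sum (n : ℕ) :
    Real.log (n + 1) ≤ ∑ i ∈ Finset.Icc 1 n, 1 / (i : ℝ) := by
  have := log_add_one_le_harmonic n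
  rw [harmonic_eq_sum_Icc] at this
  push_cast at this
  simpa only [one_div] using this

theorem sum_one_div_Ioc_le {q : ℕ} (hq : 0 < q) {s : ℝ} (hs : 1 ≤ s) :
    ∑ t ∈ Finset.Ioc ⌊q / s⌋₊ (2 * q), 1 / (t : ℝ) ≤ 2 + Real.log s := by
  have hq' : (0 : ℝ) < q := by exact_mod_cast hq
  set h := ⌊q / s⌋₊ with hh
  have hhq : h ≤ 2 * q := by
    have : h ≤ q := by
      rw [hh]
      apply Nat.floor_le_of_le
      exact div_le_self hq'.le hs
    omega
  have hsplit : ∑ t ∈ Finset.Icc 1 (2 * q), 1 / (t : ℝ) =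
      ∑ t ∈ Finset.Icc 1 h, 1 / (t : ℝ) + ∑ t ∈ Finset.Ioc h (2 * q), 1 / (t : ℝ) := by
    have e : ∀ m : ℕ, Finset.Icc 1 m = Finset.Ioc 0 m := fun m => rfl
    rw [e, e, Finset.sum_Ioc_consecutive _ (Nat.zero_le h) hhq]
  have h1 := sum_one_div_le (2 * q)
  have h2 := log_add_one_le_sum h
  have h3 : Real.log (q / s) ≤ Real.log (h + 1) :=
    Real.log_le_log (by positivity) (Nat.lt_floor_add_one _).le
  rw [Real.log_div hq'.ne' (by positivity)] at h3
  push_cast at h1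
  rw [Real.log_mul (by norm_num) hq'.ne'] at h1
  have h4 : Real.log 2 ≤ 1 := by linarith [Real.log_two_lt_d9]
  linarith

theorem abs_sum_min_sub {α : ℝ} {q q' a : ℕ} {p p' σ : ℤ} {δ δ' s : ℝ} (h : Irrational α)
    (H : IsConvergentPair α q q' a p p' σ δ δ') {M : ℕ} (hM : q ≤ M) (hs : 1 ≤ s)
    (hB : ∀ x, |∑ n ∈ Finset.range M, saw (n * α + x)| ≤ 3 * s) :
    |∑ n ∈ Finset.range M, min (1 / distNearestInt (((n + 1 : ℕ) : ℝ) * α)) ((2 * q : ℕ) : ℝ) -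
      2 * M * Real.log q| ≤ 44 * (1 + Real.log s) * M := by
  have hq : (0 : ℝ) < q := by exact_mod_cast H.den_pos
  have hq1 : 1 ≤ q := H.den_pos
  have hM' : (q : ℝ) ≤ M := by exact_mod_cast hM
  set A : ℕ → ℝ := fun t => ∑ n ∈ Finset.range M, nearInd (((n + 1 : ℕ) : ℝ) * α) t with hA
  have hfirst : |∑ n ∈ Finset.range M, min (1 / distNearestInt (((n + 1 : ℕ) : ℝ) * α))
      ((2 * q : ℕ) : ℝ) - ∑ t ∈ Finset.Icc 2 (2 * q), A t| ≤ 2 * M := by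
    rw [hA, Finset.sum_comm, ← Finset.sum_sub_distrib]
    refine (Finset.abs_sum_le_sum_abs _ _).trans ?_
    refine (Finset.sum_le_sum fun n _ =>
      abs_min_sub_sum_nearInd (irrational_natCast_mul h n.succ_pos) (Q := 2 * q)
        (by omega)).trans ?_
    rw [Finset.sum_const, Finset.card_range, nsmul_eq_mul, mul_comm]
  -- The cut `q / s` balances two estimates: below it the discrepancy `6 * s` totals at most `6 *
  -- q`; above it the terms of size `M / t` total `O(M (1 + log s))`.
  set h0 := ⌊q / s⌋₊ with hh0
  have hterm : ∀ t ∈ Finset.Icc 2 (2 * q), |A t - 2 * M / t| ≤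
      (if t ≤ h0 then 6 * s else 0) + (if t ≤ h0 then 0 else 4 * M * (1 / (t : ℝ))) +
        12 * M / q := by
    intro t ht
    have ht2 := (Finset.mem_Icc.1 ht).1
    have hp : (0 : ℝ) ≤ 12 * M / q := by positivity
    split_ifs with hc
    · have := abs_sum_nearInd_sub h hB ht2
      linarith
    · have h1 := sum_nearInd_le h H hM ht2
      have h2 : 0 ≤ A t := Finset.sum_nonneg fun n _ => nearInd_nonneg _ _
      have e1 : 4 * (M : ℝ) * (1 / t) = 4 * M / t := by ring
      have e2 : (2 : ℝ) * M / t ≤ 4 * M / t := by gcongr; norm_num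
      have e3 : (0 : ℝ) ≤ 2 * M / t := by positivity
      rw [e1, abs_le]
      constructor <;> linarith
  have hsecond : |∑ t ∈ Finset.Icc 2 (2 * q), A t - ∑ t ∈ Finset.Icc 2 (2 * q), 2 * (M : ℝ) / t| ≤
      6 * M + 4 * M * (2 + Real.log s) + 24 * M := by
    rw [← Finset.sum_sub_distrib]
    refine (Finset.abs_sum_le_sum_abs _ _).trans ((Finset.sum_le_sum hterm).trans ?_)
    rw [Finset.sum_add_distrib, Finset.sum_add_distrib]
    have g1 : ∑ t ∈ Finset.Icc 2 (2 * q), (if t ≤ h0 then 6 * s else 0) ≤ 6 * M := by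
      rw [← Finset.sum_filter, Finset.sum_const, nsmul_eq_mul]
      have hc : ((Finset.Icc 2 (2 * q)).filter (fun t => t ≤ h0)).card ≤ h0 := by
        calc _ ≤ (Finset.Icc 1 h0).card := by
              apply Finset.card_le_card
              intro t ht
              simp only [Finset.mem_filter, Finset.mem_Icc] at ht ⊢
              omega
          _ = h0 := by simp
      have hc' : (((Finset.Icc 2 (2 * q)).filter (fun t => t ≤ h0)).card : ℝ) ≤ q / s :=
        (Nat.cast_le.2 hc).trans (Nat.floor_le (by positivity))
      calc _ ≤ q / s * (6 * s) := by gcongr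
        _ = 6 * q := by field_simp
        _ ≤ _ := by linarith
    have g2 : ∑ t ∈ Finset.Icc 2 (2 * q), (if t ≤ h0 then 0 else 4 * M * (1 / (t : ℝ))) ≤
        4 * M * (2 + Real.log s) := by
      have e : ∀ t ∈ Finset.Icc 2 (2 * q), (if t ≤ h0 then 0 else 4 * M * (1 / (t : ℝ))) =
          if h0 < t then 4 * M * (1 / (t : ℝ)) else 0 := by
        intro t _
        split_ifs <;> first | rfl | omega
      rw [Finset.sum_congr rfl e, ← Finset.sum_filter]
      calc _ ≤ ∑ t ∈ Finset.Ioc h0 (2 * q), 4 * M * (1 / (t : ℝ)) := by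
            apply Finset.sum_le_sum_of_subset_of_nonneg
            · intro t ht
              simp only [Finset.mem_filter, Finset.mem_Icc, Finset.mem_Ioc] at ht ⊢
              omega
            · intro t _ _; positivity
        _ = 4 * M * ∑ t ∈ Finset.Ioc h0 (2 * q), 1 / (t : ℝ) := by rw [Finset.mul_sum]
        _ ≤ _ := by
            have := sum_one_div_Ioc_le H.den_pos hs
            gcongr
    have g3 : ∑ t ∈ Finset.Icc 2 (2 * q), 12 * (M : ℝ) / q ≤ 24 * M := by
      rw [Finset.sum_const, nsmul_eq_mul, Nat.card_Icc]
      have : ((2 * q + 1 - 2 : ℕ) : ℝ) ≤ 2 * q := by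
        exact_mod_cast (show 2 * q + 1 - 2 ≤ 2 * q by omega)
      calc _ ≤ 2 * (q : ℝ) * (12 * M / q) := by gcongr
        _ = 24 * M := by field_simp; ring
    linarith
  have hmain : |∑ t ∈ Finset.Icc 2 (2 * q), 2 * (M : ℝ) / t - 2 * M * Real.log q| ≤ 4 * M := by
    have e : ∑ t ∈ Finset.Icc 2 (2 * q), 2 * (M : ℝ) / t =
        2 * M * (∑ t ∈ Finset.Icc 1 (2 * q), 1 / (t : ℝ) - 1) := by
      rw [← Finset.add_sum_Ioc_eq_sum_Icc (show 1 ≤ 2 * q by omega)]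
      have : Finset.Ioc 1 (2 * q) = Finset.Icc 2 (2 * q) := rfl
      rw [this, Nat.cast_one, div_one, add_sub_cancel_left, Finset.mul_sum]
      exact Finset.sum_congr rfl fun t _ => by ring
    rw [e, ← mul_sub, abs_mul, abs_of_nonneg (by positivity)]
    have h1 := sum_one_div_le (2 * q)
    have h2 := log_add_one_le_sum (2 * q)
    push_cast at h1 h2
    have h3 : Real.log q ≤ Real.log (2 * q + 1) := Real.log_le_log hq (by linarith)
    rw [Real.log_mul (by norm_num) hq.ne'] at h1
    have h4 : Real.log 2 ≤ 1 := by linarith [Real.log_two_lt_d9]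
    have : |∑ t ∈ Finset.Icc 1 (2 * q), 1 / (t : ℝ) - 1 - Real.log q| ≤ 2 := by
      rw [abs_le]; constructor <;> linarith
    nlinarith
  have hl : 0 ≤ Real.log s := Real.log_nonneg hs
  have hMl : 0 ≤ M * Real.log s := by positivity
  have a1 := abs_le.1 hfirst
  have a2 := abs_le.1 hsecond
  have a3 := abs_le.1 hmain
  rw [abs_le]
  constructor <;> nlinarith

/-! ### The contribution of one block `q ≤ n < a * q + q'` -/

theorem one_div_succ_le_log {n : ℕ} (hn : 0 < n) :
    1 / ((n : ℝ) + 1) ≤ Real.log (n + 1) - Real.log n := by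
  have hn' : (0 : ℝ) < n := by exact_mod_cast hn
  rw [← Real.log_div (by positivity) hn'.ne']
  have := Real.one_sub_inv_le_log_of_pos (x := ((n : ℝ) + 1) / n) (by positivity)
  refine le_trans (le_of_eq ?_) this
  field_simp
  ring

theorem log_succ_sub_le {n : ℕ} (hn : 0 < n) : Real.log (n + 1) - Real.log n ≤ 1 / (n : ℝ) := by
  have hn' : (0 : ℝ) < n := by exact_mod_cast hn
  rw [← Real.log_div (by positivity) hn'.ne']
  have := Real.log_le_sub_one_of_pos (x := ((n : ℝ) + 1) / n) (by positivity)
  refine this.trans (le_of_eq ?_)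
  field_simp
  ring

theorem sum_Ioc_one_div_bounds {q M : ℕ} (hq : 0 < q) (hM : q ≤ M) :
    ∑ n ∈ Finset.Ioc q M, 1 / (n : ℝ) ≤ Real.log M - Real.log q ∧
      Real.log (M + 1) - Real.log q - 1 / q ≤ ∑ n ∈ Finset.Ioc q M, 1 / (n : ℝ) := by
  induction M, hM using Nat.le_induction with
  | base =>
    have := log_succ_sub_le hq
    simp only [Finset.Ioc_self, Finset.sum_empty]
    constructor <;> linarith
  | succ M hM ih =>
    rw [Finset.sum_Ioc_succ_top hM]
    have h1 := one_div_succ_le_log (lt_of_lt_of_le hq hM)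
    have h2 := log_succ_sub_le M.succ_pos
    push_cast at h2 ⊢
    constructor <;> linarith [ih.1, ih.2]

/-- Abel summation: the two boundary terms `G m / m` cost `e` each, and the interior terms `G m / (m
(m + 1))` give the harmonic sum. -/
theorem abs_sum_div_le_of_partial_sums {g : ℕ → ℝ} {q M : ℕ} {e : ℝ} (hq : 0 < q) (hM : q ≤ M)
    (hG : ∀ m, q ≤ m → m ≤ M → |∑ n ∈ Finset.range m, g (n + 1)| ≤ e * m) :
    |∑ n ∈ Finset.Ioc q M, g n / n| ≤ 2 * e + e * ∑ n ∈ Finset.Ioc q M, 1 / (n : ℝ) := by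
  set G : ℕ → ℝ := fun m => ∑ n ∈ Finset.range m, g (n + 1) with hGdef
  have hGdiv : ∀ m, q ≤ m → m ≤ M → |G m / m| ≤ e := by
    intro m h1 h2
    have hm : (0 : ℝ) < m := by exact_mod_cast lt_of_lt_of_le hq h1
    rw [abs_div, abs_of_pos hm, div_le_iff₀ hm]
    exact hG m h1 h2
  have key : ∀ m, q ≤ m → m ≤ M →
      |∑ n ∈ Finset.Ioc q m, g n / n - (G m / m - G q / q)| ≤
        e * ∑ n ∈ Finset.Ioc q m, 1 / (n : ℝ) := by
    intro m hm
    induction m, hm using Nat.le_induction with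
    | base => intro _; simp
    | succ m hm ih =>
      intro hmM
      have ih' := ih (by omega)
      have hm0 : (0 : ℝ) < m := by exact_mod_cast lt_of_lt_of_le hq hm
      rw [Finset.sum_Ioc_succ_top hm, Finset.sum_Ioc_succ_top hm]
      have hGs : G (m + 1) = G m + g (m + 1) := Finset.sum_range_succ _ _
      have e1 : ∑ n ∈ Finset.Ioc q m, g n / n + g (m + 1) / ((m + 1 : ℕ) : ℝ) -
          (G (m + 1) / ((m + 1 : ℕ) : ℝ) - G q / q) =
          (∑ n ∈ Finset.Ioc q m, g n / n - (G m / m - G q / q)) +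
            G m / m * (1 / ((m + 1 : ℕ) : ℝ)) := by
        rw [hGs]
        push_cast
        field_simp
        ring
      rw [e1, mul_add]
      refine (abs_add_le _ _).trans (add_le_add ih' ?_)
      rw [abs_mul, abs_of_nonneg (by positivity : (0 : ℝ) ≤ 1 / ((m + 1 : ℕ) : ℝ))]
      exact mul_le_mul_of_nonneg_right (hGdiv m hm (by omega)) (by positivity)
  have h1 := abs_le.1 (key M hM le_rfl)
  have h2 := abs_le.1 (hGdiv M hM le_rfl)
  have h3 := abs_le.1 (hGdiv q le_rfl hM)
  rw [abs_le]
  constructor <;> linarith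

namespace IsConvergentPair

variable {α : ℝ} {q q' a : ℕ} {p p' σ : ℤ} {δ δ' : ℝ}

theorem log_ratio_le (H : IsConvergentPair α q q' a p p' σ δ δ') {M : ℕ} {s : ℝ}
    (hMa : M + 1 ≤ a * q + q') (ha : (a : ℝ) ≤ s) :
    Real.log (M + 1) - Real.log q ≤ 1 + Real.log s := by
  have hq : (0 : ℝ) < q := by exact_mod_cast H.den_pos
  have ha1 : (1 : ℝ) ≤ a := by exact_mod_cast H.quot_pos
  have h1 : (M : ℝ) + 1 ≤ a * q + q' := by exact_mod_cast hMa
  have h2 : (q' : ℝ) ≤ q := by exact_mod_cast H.den_le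
  have h3 : (M : ℝ) + 1 ≤ 2 * s * q := by nlinarith
  have h4 := Real.log_le_log (by positivity) h3
  have hs : 0 < s := by linarith
  rw [Real.log_mul (by positivity) hq.ne', Real.log_mul (by norm_num) hs.ne'] at h4
  linarith [Real.log_two_lt_d9]

theorem log_ratio_nonneg (H : IsConvergentPair α q q' a p p' σ δ δ') {M : ℕ} (hM : q ≤ M) :
    0 ≤ Real.log (M + 1) - Real.log q := by
  have hq : (0 : ℝ) < q := by exact_mod_cast H.den_pos
  have hM' : (q : ℝ) ≤ M := by exact_mod_cast hM
  have := Real.log_le_log hq (show (q : ℝ) ≤ M + 1 by linarith)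
  linarith

theorem abs_sum_truncated_sub (H : IsConvergentPair α q q' a p p' σ δ δ') (h : Irrational α)
    {M : ℕ} {s : ℝ} (hM : q ≤ M) (hMa : M + 1 ≤ a * q + q') (ha : (a : ℝ) ≤ s)
    (hB : ∀ m ≤ M, ∀ x, |∑ n ∈ Finset.range m, saw (n * α + x)| ≤ 3 * s) :
    |∑ n ∈ Finset.Icc q M, min (1 / distNearestInt ((n : ℝ) * α)) ((2 * q : ℕ) : ℝ) / n -
        (Real.log (M + 1) ^ 2 - Real.log q ^ 2)| ≤
      100 * ((1 + Real.log s) * (1 + (Real.log (M + 1) - Real.log q))) := by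
  have hq : (0 : ℝ) < q := by exact_mod_cast H.den_pos
  have hq1 : (1 : ℝ) ≤ q := by exact_mod_cast H.den_pos
  have ha1 : (1 : ℝ) ≤ a := by exact_mod_cast H.quot_pos
  have hs : 1 ≤ s := ha1.trans ha
  have hl := Real.log_nonneg hs
  have hlq := Real.log_nonneg hq1
  set f : ℕ → ℝ := fun n => min (1 / distNearestInt ((n : ℝ) * α)) ((2 * q : ℕ) : ℝ) with hf
  set c := 2 * Real.log q with hc
  set lam := Real.log (M + 1) - Real.log q with hlam
  have hlam0 : 0 ≤ lam := H.log_ratio_nonneg hM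
  have hlam1 : lam ≤ 1 + Real.log s := H.log_ratio_le hMa ha
  have habel := abs_sum_div_le_of_partial_sums (g := fun n => f n - c)
    (e := 44 * (1 + Real.log s)) H.den_pos hM (fun m hm hmM => by
      have := abs_sum_min_sub h H hm hs (hB m hmM)
      rw [Finset.sum_sub_distrib, Finset.sum_const, Finset.card_range, nsmul_eq_mul]
      have e1 : (m : ℝ) * c = 2 * m * Real.log q := by rw [hc]; ring
      rw [e1]
      exact this)
  obtain ⟨hup, hlow⟩ := sum_Ioc_one_div_bounds H.den_pos hM
  set S := ∑ n ∈ Finset.Ioc q M, 1 / (n : ℝ) with hS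
  have hMlog : Real.log M ≤ Real.log (M + 1) :=
    Real.log_le_log (by exact_mod_cast lt_of_lt_of_le H.den_pos hM) (by linarith)
  have hSlam : S ≤ lam := by linarith
  -- The term `n = q` is outside the Abel summation; truncation at `2 * q` makes it at most `2`.
  have hsplit : ∑ n ∈ Finset.Icc q M, f n / n =
      f q / q + ∑ n ∈ Finset.Ioc q M, (f n - c) / n + c * S := by
    rw [← Finset.add_sum_Ioc_eq_sum_Icc hM, hS, Finset.mul_sum, add_assoc,
      ← Finset.sum_add_distrib]
    congr 1
    refine Finset.sum_congr rfl fun n _ => ?_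
    ring
  have hfq0 : 0 ≤ f q / q := by
    have : 0 ≤ f q := le_min (one_div_nonneg.2 (abs_nonneg _)) (by positivity)
    positivity
  have hfq2 : f q / q ≤ 2 := by
    rw [div_le_iff₀ hq]
    refine (min_le_right _ _).trans ?_
    push_cast
    exact le_rfl
  have hcS1 : c * S ≤ c * lam := by gcongr
  have hcS2 : c * lam - 2 ≤ c * S := by
    have h1 : c * (lam - 1 / q) ≤ c * S := by gcongr
    have h2 : c * (1 / q) ≤ 2 := by
      rw [mul_one_div, div_le_iff₀ hq, hc]
      have := Real.log_le_sub_one_of_pos hq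
      linarith
    linarith
  have hsq : Real.log (M + 1) ^ 2 - Real.log q ^ 2 = c * lam + lam ^ 2 := by
    rw [hc, hlam]; ring
  have hee : 44 * (1 + Real.log s) * S ≤ 44 * (1 + Real.log s) * lam := by gcongr
  -- The mean value yields `2 * log q * lam`, short of the increment of `log²` by `lam ^ 2`; a block
  -- is short enough on the logarithmic scale for this to be an error term.
  have hll : lam ^ 2 ≤ (1 + Real.log s) * lam := by
    rw [sq]; gcongr
  have hl2 : 0 ≤ lam ^ 2 := sq_nonneg _
  have hab := abs_le.1 habel
  have hprod : 0 ≤ (1 + Real.log s) * lam := by positivity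
  have hexp : 100 * ((1 + Real.log s) * (1 + lam)) =
    100 * (1 + Real.log s) + 100 * ((1 + Real.log s) * lam) := by ring
  rw [hsplit, hsq, hexp, abs_le]
  constructor <;> linarith

/-- The multiples of `α` in the block that are very close to an integer come from the two
convergents. -/
theorem eq_of_dist_lt (H : IsConvergentPair α q q' a p p' σ δ δ') {n : ℕ} (hqn : q ≤ n)
    (hn : n < a * q + q') (hd : distNearestInt ((n : ℝ) * α) < 1 / (2 * q)) :
    (∃ u : ℕ, 1 ≤ u ∧ n = u * q ∧ distNearestInt ((n : ℝ) * α) = u * δ) ∨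
      ∃ u : ℕ, u < a ∧ n = u * q + q' ∧ distNearestInt ((n : ℝ) * α) = δ' - u * δ := by
  have hq : (0 : ℝ) < q := by exact_mod_cast H.den_pos
  have hqz : (0 : ℤ) < q := by exact_mod_cast H.den_pos
  have hδ := H.err_pos
  set m : ℤ := round ((n : ℝ) * α) with hm
  have hdm : distNearestInt ((n : ℝ) * α) = |(n : ℝ) * α - m| := rfl
  rw [hdm] at hd ⊢
  have hσ := H.sign_mul_self
  have hdet := H.int_det
  -- Coordinates of `(n, m)` in the unimodular basis `(q, p)`, `(q', p')`.
  set u : ℤ := σ * (p' * n - q' * m) with hu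
  set v : ℤ := σ * (q * m - p * n) with hv
  have hnuv : (n : ℤ) = u * q + v * q' := by
    rw [hu, hv]
    linear_combination (-(n : ℤ)) * hσ - σ * n * hdet
  have hmuv : m = u * p + v * p' := by
    rw [hu, hv]
    linear_combination (-m) * hσ - σ * m * hdet
  have hform : (n : ℝ) * α - m = σ * (u * δ - v * δ') := by
    have h1 : (n : ℝ) = u * q + v * q' := by exact_mod_cast hnuv
    have h2 : (m : ℝ) = u * p + v * p' := by exact_mod_cast hmuv
    rw [h1, h2]
    linear_combination (u : ℝ) * H.err + (v : ℝ) * H.err'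
  have hdist : |(n : ℝ) * α - m| = |u * δ - v * δ'| := by
    rw [hform, abs_mul, H.abs_sign, one_mul]
  -- Up to sign, `v` is `n(qα - p) - q(nα - m)`. The first product is below `qδ' + q'δ = 1` in
  -- absolute value, the second at most `1 / 2`.
  have hvabs : |(v : ℝ)| < 2 := by
    have e1 : (v : ℝ) = σ * (n * (q * α - p) - q * (n * α - m)) := by
      rw [hv]; push_cast; ring
    have hqd : (q : ℝ) * |(n : ℝ) * α - m| ≤ 1 / 2 := by
      calc _ ≤ (q : ℝ) * (1 / (2 * q)) := by gcongr
        _ = 1 / 2 := by field_simp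
    have hnd : (n : ℝ) * δ < 1 := by
      have h1 : (n : ℝ) < a * q + q' := by exact_mod_cast hn
      have h2 : (n : ℝ) * δ < (a * q + q') * δ := by gcongr
      have h3 := mul_lt_mul_of_pos_left H.lower hq
      nlinarith [H.det]
    rw [e1, abs_mul, H.abs_sign, one_mul]
    refine (abs_sub _ _).trans_lt ?_
    rw [abs_mul, abs_mul, H.abs_err, abs_of_pos hq, Nat.abs_cast]
    linarith
  have hv2 : -2 < v ∧ v < 2 := by
    have := abs_lt.1 hvabs
    constructor
    · exact_mod_cast this.1
    · exact_mod_cast this.2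
  have hq'z : (q' : ℤ) ≤ q := by exact_mod_cast H.den_le
  have hqnz : (q : ℤ) ≤ n := by exact_mod_cast hqn
  have hnz : (n : ℤ) < a * q + q' := by exact_mod_cast hn
  have hq'0 : (0 : ℤ) ≤ q' := by positivity
  -- For `v = -1` positivity of `n` forces `u ≥ 1`, so the distance `uδ + δ'` is at least `1 /
  -- (2q)`, a contradiction. The other two values give the two families.
  obtain hv' | hv' | hv' : v = -1 ∨ v = 0 ∨ v = 1 := by omega
  · exfalso
    have hu1 : 1 ≤ u := by
      by_contra hcon
      have : u ≤ 0 := by omega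
      nlinarith
    have hu1' : (1 : ℝ) ≤ u := by exact_mod_cast hu1
    have h1 : δ' ≤ |u * δ - v * δ'| := by
      rw [hv']
      refine le_trans ?_ (le_abs_self _)
      push_cast
      nlinarith
    have h2 : 1 / (2 * (q : ℝ)) ≤ δ' := by
      rw [div_le_iff₀ (by positivity)]
      linarith [H.one_le_two_mul]
    linarith
  · left
    have hu1 : 1 ≤ u := by
      by_contra hcon
      have : u ≤ 0 := by omega
      nlinarith
    obtain ⟨w, hw⟩ := Int.eq_ofNat_of_zero_le (show 0 ≤ u by omega)
    refine ⟨w, by omega, ?_, ?_⟩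
    · rw [hv', hw] at hnuv
      have : (n : ℤ) = ((w * q : ℕ) : ℤ) := by push_cast; linarith
      exact_mod_cast this
    · rw [hdist, hv', hw]
      push_cast
      rw [zero_mul, sub_zero, abs_of_nonneg (by positivity)]
  · right
    have hu0 : 0 ≤ u := by
      by_contra hcon
      have : u ≤ -1 := by omega
      nlinarith
    obtain ⟨w, hw⟩ := Int.eq_ofNat_of_zero_le hu0
    have hwa : w < a := by
      by_contra hcon
      have : (a : ℤ) ≤ w := by omega
      nlinarith
    have hwa' : (w : ℝ) + 1 ≤ a := by exact_mod_cast hwa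
    refine ⟨w, hwa, ?_, ?_⟩
    · rw [hv', hw] at hnuv
      have : (n : ℤ) = ((w * q + q' : ℕ) : ℤ) := by push_cast; linarith
      exact_mod_cast this
    · rw [hdist, hv', hw]
      push_cast
      rw [one_mul, abs_sub_comm, abs_of_nonneg]
      nlinarith [H.lower]

theorem one_div_mul_le_of_second (H : IsConvergentPair α q q' a p p' σ δ δ') {n u : ℕ}
    (hqn : q ≤ n) (hu : u < a) (hn : n = u * q + q') :
    1 / (δ' - u * δ) / n ≤ 2 * (a + 2) / ((u + 1) * (a - u)) := by
  have hq : (0 : ℝ) < q := by exact_mod_cast H.den_pos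
  have hδ := H.err_pos
  have hu' : (u : ℝ) + 1 ≤ a := by exact_mod_cast hu
  have hqn' : (q : ℝ) ≤ n := by exact_mod_cast hqn
  have hau : (0 : ℝ) < a - u := by linarith
  have h1 : ((a : ℝ) - u) * δ ≤ δ' - u * δ := by nlinarith [H.lower]
  -- Add `n ≥ u * q` and `n ≥ q`; the latter is needed at `u = 0`, where `n = q'`.
  have h2 : ((u : ℝ) + 1) * q ≤ 2 * n := by
    have h3 : (n : ℝ) = u * q + q' := by exact_mod_cast hn
    have h4 : (0 : ℝ) ≤ q' := by positivity
    have h5 : (0 : ℝ) ≤ u := by positivity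
    nlinarith
  have hn0 : (0 : ℝ) < n := by linarith
  have hpos : (0 : ℝ) < ((a : ℝ) - u) * δ := by positivity
  rw [div_div, div_le_div_iff₀ (by nlinarith) (by positivity), one_mul]
  have h6 := H.le_add_two_mul
  have hprod : (((u : ℝ) + 1) * q) * (((a : ℝ) - u) * δ) ≤ (2 * n) * (δ' - u * δ) := by
    gcongr
  calc ((u : ℝ) + 1) * (a - u) ≤ ((a + 2) * (q * δ)) * ((u + 1) * (a - u)) := by
        refine le_mul_of_one_le_left (by positivity) h6
    _ = (a + 2) * ((((u : ℝ) + 1) * q) * (((a : ℝ) - u) * δ)) := by ring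
    _ ≤ (a + 2) * ((2 * n) * (δ' - u * δ)) := by gcongr
    _ = _ := by ring

end IsConvergentPair

/-! ### Elementary sums for the points near the convergents -/

theorem sum_one_div_mul_reflect_le {a : ℕ} (ha : 1 ≤ a) :
    ∑ u ∈ Finset.range a, 2 * ((a : ℝ) + 2) / ((u + 1) * (a - u)) ≤ 8 * (1 + Real.log a) := by
  have ha' : (1 : ℝ) ≤ a := by exact_mod_cast ha
  have e : ∀ u ∈ Finset.range a, 2 * ((a : ℝ) + 2) / ((u + 1) * (a - u)) =
      2 * (a + 2) / (a + 1) * (1 / ((u : ℝ) + 1) + 1 / ((a : ℝ) - u)) := by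
    intro u hu
    have : (u : ℝ) + 1 ≤ a := by exact_mod_cast Finset.mem_range.1 hu
    have h1 : (a : ℝ) - u ≠ 0 := by linarith
    field_simp
    ring
  have h1 : ∑ u ∈ Finset.range a, 1 / ((u : ℝ) + 1) ≤ 1 + Real.log a := by
    refine le_trans (le_of_eq ?_) (sum_one_div_le a)
    have := Finset.sum_Ico_add' (fun n : ℕ => 1 / (n : ℝ)) 0 a 1
    rw [← Finset.range_eq_Ico] at this
    push_cast at this
    rw [this]
    rfl
  have h2 : ∑ u ∈ Finset.range a, 1 / ((a : ℝ) - u) = ∑ u ∈ Finset.range a, 1 / ((u : ℝ) + 1) := by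
    rw [← Finset.sum_range_reflect]
    refine Finset.sum_congr rfl fun u hu => ?_
    have hu' := Finset.mem_range.1 hu
    have : ((a - 1 - u : ℕ) : ℝ) = a - 1 - u := by
      rw [Nat.cast_sub (by omega), Nat.cast_sub ha]; simp
    rw [this]
    congr 1
    ring
  rw [Finset.sum_congr rfl e, ← Finset.mul_sum, Finset.sum_add_distrib, h2]
  have h3 : 2 * ((a : ℝ) + 2) / (a + 1) ≤ 4 := by
    rw [div_le_iff₀ (by positivity)]; linarith
  have h4 : 0 ≤ ∑ u ∈ Finset.range a, 1 / ((u : ℝ) + 1) :=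
    Finset.sum_nonneg fun u _ => by positivity
  nlinarith

/-- The partial sums increase to `π² / 6`, while adding `2 / (J + 1)` makes them decrease to the
same limit. -/
theorem sum_one_div_sq_bounds (J : ℕ) :
    ∑ j ∈ Finset.Icc 1 J, 1 / (j : ℝ) ^ 2 ≤ Real.pi ^ 2 / 6 ∧
      Real.pi ^ 2 / 6 ≤ ∑ j ∈ Finset.Icc 1 J, 1 / (j : ℝ) ^ 2 + 2 / ((J : ℝ) + 1) := by
  set S : ℕ → ℝ := fun J => ∑ j ∈ Finset.Icc 1 J, 1 / (j : ℝ) ^ 2 with hS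
  have hsucc : ∀ J, S (J + 1) = S J + 1 / ((J : ℝ) + 1) ^ 2 := by
    intro J
    simp only [hS]
    rw [Finset.sum_Icc_succ_top (by omega)]
    push_cast
    rfl
  have hlim : Filter.Tendsto S Filter.atTop (nhds (Real.pi ^ 2 / 6)) := by
    have h1 := (hasSum_zeta_two.tendsto_sum_nat).comp (Filter.tendsto_add_atTop_nat 1)
    refine h1.congr fun J => ?_
    induction J with
    | zero => simp [hS]
    | succ J ih =>
      simp only [Function.comp_apply] at ih ⊢
      rw [Finset.sum_range_succ, ih, hsucc]
      push_cast
      rfl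
  refine ⟨?_, ?_⟩
  · refine (monotone_nat_of_le_succ fun J => ?_).ge_of_tendsto hlim J
    rw [hsucc]
    linarith [show (0 : ℝ) ≤ 1 / ((J : ℝ) + 1) ^ 2 by positivity]
  · have hlim2 : Filter.Tendsto (fun J : ℕ => S J + 2 * (1 / ((J : ℝ) + 1))) Filter.atTop
        (nhds (Real.pi ^ 2 / 6 + 2 * 0)) :=
      hlim.add (tendsto_one_div_add_atTop_nhds_zero_nat.const_mul 2)
    rw [mul_zero, add_zero] at hlim2
    have hanti : Antitone (fun J : ℕ => S J + 2 * (1 / ((J : ℝ) + 1))) := by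
      refine antitone_nat_of_succ_le fun J => ?_
      rw [hsucc]
      push_cast
      have : 1 / ((J : ℝ) + 1) ^ 2 ≤ 2 * (1 / ((J : ℝ) + 1)) - 2 * (1 / ((J : ℝ) + 1 + 1)) := by
        have e : 2 * (1 / ((J : ℝ) + 1)) - 2 * (1 / ((J : ℝ) + 1 + 1)) =
            2 / (((J : ℝ) + 1) * (J + 1 + 1)) := by
          field_simp
          ring
        rw [e, div_le_div_iff₀ (by positivity) (by positivity)]
        have : (0 : ℝ) ≤ J := by positivity
        nlinarith
      linarith
    have := hanti.le_of_tendsto hlim2 J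
    rwa [mul_one_div] at this

theorem sum_one_div_sq_le_two (J : ℕ) : ∑ j ∈ Finset.Icc 1 J, 1 / (j : ℝ) ^ 2 ≤ 2 := by
  have h1 := (sum_one_div_sq_bounds J).1
  have h2 := Real.pi_lt_d2
  have h3 := Real.pi_pos
  nlinarith

/-- Each `j` feeds only `n = φ j`, so every weight is counted at most once, whether or not `φ` is
injective or maps into `s`. -/
theorem sum_ite_natCast_eq_le {s : Finset ℕ} {t : Finset ℕ} {w : ℕ → ℝ} (φ : ℕ → ℕ)
    (hw : ∀ j ∈ t, 0 ≤ w j) :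
    ∑ n ∈ s, ∑ j ∈ t, (if n = φ j then w j else 0) ≤ ∑ j ∈ t, w j := by
  rw [Finset.sum_comm]
  refine Finset.sum_le_sum fun j hj => ?_
  rw [Finset.sum_ite_eq']
  split_ifs
  · exact le_rfl
  · exact hw j hj

namespace IsConvergentPair

variable {α : ℝ} {q q' a : ℕ} {p p' σ : ℤ} {δ δ' : ℝ}

theorem sum_excess_le (H : IsConvergentPair α q q' a p p' σ δ δ') (h : Irrational α)
    {M : ℕ} (hMa : M + 1 ≤ a * q + q') :
    ∑ n ∈ Finset.Icc q M, (1 / distNearestInt ((n : ℝ) * α) -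
        min (1 / distNearestInt ((n : ℝ) * α)) ((2 * q : ℕ) : ℝ)) / n ≤
      ∑ j ∈ Finset.Icc 1 (M / q), ((a : ℝ) + 2) / (j : ℝ) ^ 2 +
        ∑ u ∈ Finset.range a, 2 * ((a : ℝ) + 2) / ((u + 1) * (a - u)) := by
  have hq : (0 : ℝ) < q := by exact_mod_cast H.den_pos
  have hδ := H.err_pos
  have hw1 : ∀ j ∈ Finset.Icc 1 (M / q), 0 ≤ ((a : ℝ) + 2) / (j : ℝ) ^ 2 :=
    fun j _ => by positivity
  have hw2 : ∀ u ∈ Finset.range a, 0 ≤ 2 * ((a : ℝ) + 2) / (((u : ℝ) + 1) * (a - u)) := by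
    intro u hu
    have : (u : ℝ) + 1 ≤ a := by exact_mod_cast Finset.mem_range.1 hu
    have h1 : (0 : ℝ) ≤ (a : ℝ) - u := by linarith
    positivity
  refine le_trans ?_ (add_le_add
    (sum_ite_natCast_eq_le (s := Finset.Icc q M) (fun j => j * q) hw1)
    (sum_ite_natCast_eq_le (s := Finset.Icc q M) (fun u => u * q + q') hw2))
  rw [← Finset.sum_add_distrib]
  refine Finset.sum_le_sum fun n hn => ?_
  obtain ⟨hqn, hnM⟩ := Finset.mem_Icc.1 hn
  have hn0 : 0 < n := lt_of_lt_of_le H.den_pos hqn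
  have hn0' : (0 : ℝ) < n := by exact_mod_cast hn0
  have hd0 := distNearestInt_pos (irrational_natCast_mul h hn0)
  set d := distNearestInt ((n : ℝ) * α) with hd
  have hnn1 : ∀ j ∈ Finset.Icc 1 (M / q),
      (0 : ℝ) ≤ if n = j * q then ((a : ℝ) + 2) / (j : ℝ) ^ 2 else 0 := by
    intro j hj
    split_ifs
    · exact hw1 j hj
    · exact le_rfl
  have hnn2 : ∀ u ∈ Finset.range a,
      (0 : ℝ) ≤ if n = u * q + q' then 2 * ((a : ℝ) + 2) / (((u : ℝ) + 1) * (a - u)) else 0 := by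
    intro u hu
    split_ifs
    · exact hw2 u hu
    · exact le_rfl
  rcases lt_or_ge d (1 / (2 * q)) with hlt | hge
  · have hle : (1 / d - min (1 / d) ((2 * q : ℕ) : ℝ)) / n ≤ 1 / d / n := by
      have : 0 ≤ min (1 / d) ((2 * q : ℕ) : ℝ) := le_min (by positivity) (by positivity)
      gcongr
      linarith
    refine hle.trans ?_
    rcases H.eq_of_dist_lt hqn (by omega) hlt with ⟨u, hu1, hun, hud⟩ | ⟨u, hua, hun, hud⟩
    · have humem : u ∈ Finset.Icc 1 (M / q) := by
        rw [Finset.mem_Icc]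
        refine ⟨hu1, ?_⟩
        rw [Nat.le_div_iff_mul_le H.den_pos]
        omega
      have h1 := Finset.single_le_sum hnn1 humem
      rw [if_pos hun] at h1
      have h2 := Finset.sum_nonneg hnn2
      refine le_trans ?_ (add_le_add h1 h2)
      have hu0 : (0 : ℝ) < u := by exact_mod_cast hu1
      have hn' : (n : ℝ) = u * q := by exact_mod_cast hun
      rw [← hd] at hud
      rw [hud, hn', add_zero, div_div, div_le_div_iff₀ (by positivity) (by positivity)]
      have h6 := H.le_add_two_mul
      calc 1 * (u : ℝ) ^ 2 ≤ ((a + 2) * (q * δ)) * (u : ℝ) ^ 2 := by gcongr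
        _ = _ := by ring
    · have humem : u ∈ Finset.range a := Finset.mem_range.2 hua
      have h1 := Finset.sum_nonneg hnn1
      have h2 := Finset.single_le_sum hnn2 humem
      rw [if_pos hun] at h2
      refine le_trans ?_ (add_le_add h1 h2)
      rw [← hd] at hud
      rw [hud, zero_add]
      exact H.one_div_mul_le_of_second hqn hua hun
  · have h1 : 1 / d ≤ ((2 * q : ℕ) : ℝ) := by
      push_cast
      rw [div_le_iff₀ hd0]
      have := (div_le_iff₀ (by positivity)).1 hge
      linarith
    rw [min_eq_left h1, sub_self, zero_div]
    exact add_nonneg (Finset.sum_nonneg hnn1) (Finset.sum_nonneg hnn2)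

/-- All excesses are nonnegative, so it suffices to keep the multiples `n = jq`, where `‖nα‖ ≤ jδ`
and `1 / (qδ) ≥ a`. The term `2 / j` is the truncation height `2q` divided by `jq`. -/
theorem le_sum_excess (H : IsConvergentPair α q q' a p p' σ δ δ') (h : Irrational α) (M : ℕ) :
    ∑ j ∈ Finset.Icc 1 (M / q), ((a : ℝ) / (j : ℝ) ^ 2 - 2 * (1 / (j : ℝ))) ≤
      ∑ n ∈ Finset.Icc q M, (1 / distNearestInt ((n : ℝ) * α) -
        min (1 / distNearestInt ((n : ℝ) * α)) ((2 * q : ℕ) : ℝ)) / n := by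
  have hq : (0 : ℝ) < q := by exact_mod_cast H.den_pos
  have hδ := H.err_pos
  set E : ℕ → ℝ := fun n => (1 / distNearestInt ((n : ℝ) * α) -
        min (1 / distNearestInt ((n : ℝ) * α)) ((2 * q : ℕ) : ℝ)) / n with hE
  have hE0 : ∀ n, 0 ≤ E n := fun n =>
    div_nonneg (sub_nonneg.2 (min_le_left _ _)) (by positivity)
  have hinj : Set.InjOn (fun j : ℕ => j * q) (Finset.Icc 1 (M / q)) :=
    fun i _ j _ hij => Nat.eq_of_mul_eq_mul_right H.den_pos hij
  have hsub : (Finset.Icc 1 (M / q)).image (fun j : ℕ => j * q) ⊆ Finset.Icc q M := by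
    intro n hn
    obtain ⟨j, hj, rfl⟩ := Finset.mem_image.1 hn
    obtain ⟨h1, h2⟩ := Finset.mem_Icc.1 hj
    rw [Finset.mem_Icc]
    rw [Nat.le_div_iff_mul_le H.den_pos] at h2
    exact ⟨Nat.le_mul_of_pos_left q h1, h2⟩
  refine le_trans ?_ (Finset.sum_le_sum_of_subset_of_nonneg hsub fun n _ _ => hE0 n)
  rw [Finset.sum_image hinj]
  refine Finset.sum_le_sum fun j hj => ?_
  have hj1 : 0 < j := (Finset.mem_Icc.1 hj).1
  have hj0 : (0 : ℝ) < j := by exact_mod_cast hj1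
  have hd0 := distNearestInt_pos (irrational_natCast_mul h (Nat.mul_pos hj1 H.den_pos))
  have hdle : distNearestInt (((j * q : ℕ) : ℝ) * α) ≤ j * δ := by
    refine (distNearestInt_le _ (j * p)).trans (le_of_eq ?_)
    have : ((j * q : ℕ) : ℝ) * α - ((j * p : ℤ) : ℝ) = j * (q * α - p) := by push_cast; ring
    rw [this, abs_mul, H.abs_err, Nat.abs_cast]
  have h1 : 1 / (j * δ) ≤ 1 / distNearestInt (((j * q : ℕ) : ℝ) * α) :=
    one_div_le_one_div_of_le hd0 hdle
  have h2 : (1 / (j * δ) - 2 * q) / ((j * q : ℕ) : ℝ) ≤ E (j * q) := by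
    simp only [hE]
    gcongr
    refine (min_le_right _ _).trans ?_
    push_cast
    exact le_rfl
  refine le_trans ?_ h2
  have e : (1 / (j * δ) - 2 * q) / ((j * q : ℕ) : ℝ) =
      1 / (q * δ) / (j : ℝ) ^ 2 - 2 * (1 / (j : ℝ)) := by
    push_cast
    field_simp
  rw [e]
  gcongr
  rw [le_div_iff₀ (by positivity)]
  exact H.one_le_mul

theorem abs_sum_excess_sub (H : IsConvergentPair α q q' a p p' σ δ δ') (h : Irrational α)
    {M : ℕ} {s : ℝ} (hM : q ≤ M) (hMa : M + 1 ≤ a * q + q') (ha : (a : ℝ) ≤ s) :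
    |∑ n ∈ Finset.Icc q M, (1 / distNearestInt ((n : ℝ) * α) -
        min (1 / distNearestInt ((n : ℝ) * α)) ((2 * q : ℕ) : ℝ)) / n -
        a * ∑ j ∈ Finset.Icc 1 (M / q), 1 / (j : ℝ) ^ 2| ≤
      20 * ((1 + Real.log s) * (1 + (Real.log (M + 1) - Real.log q))) := by
  have hq : (0 : ℝ) < q := by exact_mod_cast H.den_pos
  have ha1 : (1 : ℝ) ≤ a := by exact_mod_cast H.quot_pos
  have hs : 1 ≤ s := ha1.trans ha
  have hl := Real.log_nonneg hs
  have hlam0 := H.log_ratio_nonneg hM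
  have h1 := H.sum_excess_le h hMa
  have h2 := H.le_sum_excess h M
  have h3 := sum_one_div_mul_reflect_le H.quot_pos
  have h4 := sum_one_div_sq_le_two (M / q)
  have h5 := sum_one_div_le (M / q)
  have h6 : Real.log ((M / q : ℕ) : ℝ) ≤ Real.log (M + 1) - Real.log q := by
    have hJ : (0 : ℝ) < ((M / q : ℕ) : ℝ) := by exact_mod_cast Nat.div_pos hM H.den_pos
    rw [← Real.log_div (by positivity) hq.ne']
    refine Real.log_le_log hJ (Nat.cast_div_le.trans ?_)
    gcongr
    linarith
  have h7 : Real.log a ≤ Real.log s := Real.log_le_log (by linarith) ha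
  set S := ∑ j ∈ Finset.Icc 1 (M / q), 1 / (j : ℝ) ^ 2 with hS
  have e1 : ∑ j ∈ Finset.Icc 1 (M / q), ((a : ℝ) + 2) / (j : ℝ) ^ 2 = (a + 2) * S := by
    rw [hS, Finset.mul_sum]; exact Finset.sum_congr rfl fun j _ => by ring
  have e2 : ∑ j ∈ Finset.Icc 1 (M / q), ((a : ℝ) / (j : ℝ) ^ 2 - 2 * (1 / (j : ℝ))) =
      a * S - 2 * ∑ j ∈ Finset.Icc 1 (M / q), 1 / (j : ℝ) := by
    rw [Finset.sum_sub_distrib, hS, Finset.mul_sum, Finset.mul_sum]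
    congr 1
    exact Finset.sum_congr rfl fun j _ => by ring
  rw [e1] at h1
  rw [e2] at h2
  set lam := Real.log (M + 1) - Real.log q with hlam
  have hprod : 0 ≤ Real.log s * lam := by positivity
  have hexp : 20 * ((1 + Real.log s) * (1 + lam)) =
    20 + 20 * Real.log s + 20 * lam + 20 * (Real.log s * lam) := by ring
  rw [hexp, abs_le]
  constructor <;> linarith

/-- The contribution of the block `q ≤ n ≤ M`. -/
theorem abs_sum_block_sub (H : IsConvergentPair α q q' a p p' σ δ δ') (h : Irrational α)
    {M : ℕ} {s : ℝ} (hM : q ≤ M) (hMa : M + 1 ≤ a * q + q') (ha : (a : ℝ) ≤ s)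
    (hB : ∀ m ≤ M, ∀ x, |∑ n ∈ Finset.range m, saw (n * α + x)| ≤ 3 * s) :
    |∑ n ∈ Finset.Icc q M, 1 / ((n : ℝ) * distNearestInt ((n : ℝ) * α)) -
        (Real.log (M + 1) ^ 2 - Real.log q ^ 2 +
          a * ∑ j ∈ Finset.Icc 1 (M / q), 1 / (j : ℝ) ^ 2)| ≤
      120 * ((1 + Real.log s) * (1 + (Real.log (M + 1) - Real.log q))) := by
  have h1 := abs_le.1 (H.abs_sum_truncated_sub h hM hMa ha hB)
  have h2 := abs_le.1 (H.abs_sum_excess_sub h hM hMa ha)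
  have e : ∑ n ∈ Finset.Icc q M, 1 / ((n : ℝ) * distNearestInt ((n : ℝ) * α)) =
      ∑ n ∈ Finset.Icc q M, min (1 / distNearestInt ((n : ℝ) * α)) ((2 * q : ℕ) : ℝ) / n +
      ∑ n ∈ Finset.Icc q M, (1 / distNearestInt ((n : ℝ) * α) -
        min (1 / distNearestInt ((n : ℝ) * α)) ((2 * q : ℕ) : ℝ)) / n := by
    rw [← Finset.sum_add_distrib]
    refine Finset.sum_congr rfl fun n _ => ?_
    rw [← add_div, add_sub_cancel, div_div, mul_comm]
  rw [e, abs_le]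
  constructor <;> linarith

end IsConvergentPair

/-! ### Summation over the blocks -/

theorem one_le_cfSum_succ {α : ℝ} (h : Irrational α) (k : ℕ) :
    0 ≤ cfSum α k ∧ (quotNat α (k + 1) : ℝ) ≤ cfSum α (k + 1) ∧ 1 ≤ cfSum α (k + 1) := by
  have h0 : ∀ k, 0 ≤ cfSum α k := by
    intro k
    induction k with
    | zero => simp [cfSum]
    | succ k ih => rw [cfSum_succ h]; positivity
  have h1 : (1 : ℝ) ≤ quotNat α (k + 1) := by exact_mod_cast quotNat_pos h k
  have h2 := cfSum_succ h k
  have h3 := h0 k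
  exact ⟨h3, by linarith, by linarith⟩

/-- The empty block must be allowed: the first two denominators are both `1` when the first partial
quotient is `1`. -/
theorem abs_sum_Ico_block_sub {α : ℝ} (h : Irrational α) (k : ℕ) {L : ℕ}
    (hL : denNat α (k + 1) ≤ L) (hL' : L ≤ denNat α (k + 2)) :
    |∑ n ∈ Finset.Ico (denNat α (k + 1)) L, 1 / ((n : ℝ) * distNearestInt ((n : ℝ) * α)) -
        (Real.log L ^ 2 - Real.log (denNat α (k + 1)) ^ 2 +
          quotNat α (k + 1) *
            ∑ j ∈ Finset.Icc 1 ((L - 1) / denNat α (k + 1)), 1 / (j : ℝ) ^ 2)| ≤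
      120 * ((1 + Real.log (cfSum α (k + 1))) *
        (1 + (Real.log L - Real.log (denNat α (k + 1))))) := by
  have H := isConvergentPair h k
  obtain ⟨-, has, hs⟩ := one_le_cfSum_succ h k
  rcases hL.eq_or_lt with rfl | hlt
  · rw [Finset.Ico_self, Nat.div_eq_of_lt (Nat.sub_lt H.den_pos one_pos)]
    have := Real.log_nonneg hs
    simp only [Finset.sum_empty, Finset.Icc_eq_empty_of_lt zero_lt_one, sub_self, mul_zero,
      add_zero, abs_zero]
    positivity
  · obtain ⟨M, rfl⟩ : ∃ M, L = M + 1 := ⟨L - 1, by omega⟩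
    have := H.abs_sum_block_sub h (M := M) (by omega) hL' has
      (fun m hm x => abs_sum_saw_le h (k + 1) (lt_of_le_of_lt hm hL') x)
    rw [Nat.add_sub_cancel]
    push_cast
    exact this

theorem abs_sum_Ico_one_sub {α : ℝ} (h : Irrational α) (K : ℕ) {L : ℕ}
    (hL : denNat α (K + 1) ≤ L) (hL' : L ≤ denNat α (K + 2)) :
    |∑ n ∈ Finset.Ico 1 L, 1 / ((n : ℝ) * distNearestInt ((n : ℝ) * α)) -
        (Real.log L ^ 2 + Real.pi ^ 2 / 6 * cfSum α K +
          quotNat α (K + 1) *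
            ∑ j ∈ Finset.Icc 1 ((L - 1) / denNat α (K + 1)), 1 / (j : ℝ) ^ 2)| ≤
      122 * ((1 + Real.log (cfSum α (K + 1))) * (K + 1 + Real.log L)) := by
  induction K generalizing L with
  | zero =>
    have h1 := abs_sum_Ico_block_sub h 0 hL hL'
    have h2 := Real.log_nonneg (one_le_cfSum_succ h 0).2.2
    have h3 : 0 ≤ Real.log L := Real.log_natCast_nonneg L
    have e : denNat α (0 + 1) = 1 := rfl
    rw [e] at h1 ⊢
    have e2 : cfSum α 0 = 0 := by simp [cfSum]
    rw [e2]
    simp only [Nat.cast_one, Real.log_one, Nat.cast_zero] at h1 ⊢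
    have h4 : 0 ≤ (1 + Real.log (cfSum α (0 + 1))) * (0 + 1 + Real.log L) := by positivity
    have e3 : Real.log L ^ 2 + Real.pi ^ 2 / 6 * 0 +
        quotNat α (0 + 1) * ∑ j ∈ Finset.Icc 1 ((L - 1) / 1), 1 / (j : ℝ) ^ 2 =
        Real.log L ^ 2 - 0 ^ 2 +
        quotNat α (0 + 1) * ∑ j ∈ Finset.Icc 1 ((L - 1) / 1), 1 / (j : ℝ) ^ 2 := by ring
    have e4 : (1 + Real.log (cfSum α (0 + 1))) * (1 + (Real.log L - 0)) =
      (1 + Real.log (cfSum α (0 + 1))) * (0 + 1 + Real.log L) := by ring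
    rw [e3]
    rw [e4] at h1
    linarith
  | succ K ih =>
    have H := isConvergentPair h K
    set q := denNat α (K + 1) with hq
    set Q := denNat α (K + 2) with hQ
    set a := quotNat α (K + 1) with ha
    have hq0 : 0 < q := H.den_pos
    have hQ0 : 0 < Q := (den_mono_pos h (K + 1)).2
    have hqQ : q ≤ Q := (den_mono_pos h (K + 1)).1
    have h1 := abs_le.1 (ih hqQ le_rfl)
    have h2 := abs_le.1 (abs_sum_Ico_block_sub h (K + 1) hL hL')
    obtain ⟨hs0, has, hs⟩ := one_le_cfSum_succ h K
    have hsS : cfSum α (K + 1) ≤ cfSum α (K + 2) := by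
      rw [cfSum_succ h (K + 1)]; linarith [show (0 : ℝ) ≤ quotNat α (K + 1 + 1) by positivity]
    have hlog := Real.log_le_log (by linarith) hsS
    have hlog0 := Real.log_nonneg hs
    have hsplit := Finset.sum_Ico_consecutive
      (fun n : ℕ => 1 / ((n : ℝ) * distNearestInt ((n : ℝ) * α))) (show 1 ≤ Q by omega) hL
    rw [← hsplit]
    -- A complete block contains at least `a - 1` multiples of `q`, so replacing its sum of `1 / j²`
    -- by `π² / 6` costs at most `a * (2 / a) = 2`. This is the gap between the constants `120` and
    -- `122`.
    have hJ : a ≤ (Q - 1) / q + 1 := by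
      have : a * q ≤ Q := by
        have : Q = a * q + denNat α K := rfl
        omega
      rw [← Nat.sub_le_iff_le_add, Nat.le_div_iff_mul_le hq0, Nat.sub_mul]
      omega
    obtain ⟨hz1, hz2⟩ := sum_one_div_sq_bounds ((Q - 1) / q)
    set S := ∑ j ∈ Finset.Icc 1 ((Q - 1) / q), 1 / (j : ℝ) ^ 2 with hS
    have hz3 : (a : ℝ) * (Real.pi ^ 2 / 6 - S) ≤ 2 := by
      have hJ' : (a : ℝ) ≤ (((Q - 1) / q : ℕ) : ℝ) + 1 := by exact_mod_cast hJ
      calc (a : ℝ) * (Real.pi ^ 2 / 6 - S) ≤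
          ((((Q - 1) / q : ℕ) : ℝ) + 1) * (2 / ((((Q - 1) / q : ℕ) : ℝ) + 1)) := by
            gcongr; linarith
        _ = 2 := by field_simp
    have hz4 : 0 ≤ (a : ℝ) * (Real.pi ^ 2 / 6 - S) := mul_nonneg (by positivity) (by linarith)
    have hcs : cfSum α (K + 1) = cfSum α K + a := cfSum_succ h K
    rw [← hQ] at h2
    have hQlog : 0 ≤ Real.log Q := Real.log_natCast_nonneg Q
    have hQL : Real.log Q ≤ Real.log L :=
      Real.log_le_log (by exact_mod_cast hQ0) (by exact_mod_cast hL)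
    set l := Real.log (cfSum α (K + 1)) with hl
    have e1 : K + 1 + 1 = K + 2 := rfl
    rw [e1] at h2 ⊢
    set l' := Real.log (cfSum α (K + 2)) with hl'
    have hmono : (1 + l) * (K + 1 + Real.log Q) ≤ (1 + l') * (K + 1 + Real.log Q) := by
      gcongr
    have hnn : (1 + l') ≤ (1 + l') * (1 + (Real.log L - Real.log Q)) :=
      le_mul_of_one_le_right (by linarith) (by linarith)
    have hfin : (1 + l') * (((K + 1 : ℕ) : ℝ) + 1 + Real.log L) =
        (1 + l') * (K + 1 + Real.log Q) + (1 + l') * (1 + (Real.log L - Real.log Q)) := by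
      push_cast; ring
    have hpi : Real.pi ^ 2 / 6 * cfSum α (K + 1) =
        Real.pi ^ 2 / 6 * cfSum α K + a * S + a * (Real.pi ^ 2 / 6 - S) := by
      rw [hcs]; ring
    rw [hfin, hpi, abs_le]
    constructor <;> linarith

theorem index_le_log {α : ℝ} (h : Irrational α) (K : ℕ) {N : ℕ} (hN : denNat α (K + 1) ≤ N) :
    (K : ℝ) ≤ 1 + 3 * Real.log N := by
  have hN0 : 0 < N := lt_of_lt_of_le (den_mono_pos h K).2 hN
  have hlog : 0 ≤ Real.log N := Real.log_natCast_nonneg N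
  cases K with
  | zero => push_cast; linarith
  | succ n =>
    have h1 := two_pow_le_den_sq h n
    have h2 : 2 ^ n ≤ N * N :=
      h1.trans (Nat.mul_le_mul ((den_mono_pos h (n + 1)).1.trans hN) hN)
    have h3 : (2 : ℝ) ^ n ≤ N * N := by exact_mod_cast h2
    have hN' : (0 : ℝ) < N := by exact_mod_cast hN0
    have h4 := Real.log_le_log (by positivity) h3
    rw [Real.log_pow, Real.log_mul hN'.ne' hN'.ne'] at h4
    have h5 := Real.log_two_gt_d9
    have h6 : (0 : ℝ) ≤ n := by positivity
    push_cast
    nlinarith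

theorem one_le_errLog (x : ℝ) : 1 ≤ errLog x := by
  rw [errLog, Real.le_log_iff_exp_le (by positivity)]
  exact le_max_left _ _

theorem log_le_errLog {x : ℝ} (hx : 0 < x) : Real.log x ≤ errLog x :=
  Real.log_le_log hx (le_max_right _ _)

theorem theorem4 :
    ∃ C : ℝ, 0 < C ∧ ∀ α : ℝ, Irrational α → ∀ K N : ℕ,
      cfDen α K ≤ (N : ℝ) → (N : ℝ) < cfDen α (K + 1) →
      |(∑ n ∈ Finset.Icc 1 N, 1 / ((n : ℝ) * distNearestInt ((n : ℝ) * α))) -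
          ((Real.log (N : ℝ)) ^ 2 + Real.pi ^ 2 / 6 * cfSum α K +
            cfQuot α (K + 1) *
              ∑ j ∈ Finset.Icc 1 ⌊(N : ℝ) / cfDen α K⌋₊, 1 / (j : ℝ) ^ 2)| ≤
        C * ((∑ k ∈ Finset.Icc 1 (K + 1), Real.sqrt (cfQuot α k) * errLog (cfQuot α k)) +
          errLog (cfSum α (K + 1)) * errLog (N : ℝ)) := by
  -- `1710 = 122 * 2 * 7 + 2`: the factors `2` and `7` come from `hprod`, and the final `2` from
  -- replacing `log (N + 1) ^ 2` by `log N ^ 2`.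
  refine ⟨1710, by norm_num, fun α h K N hN hN' => ?_⟩
  rw [cfDen_eq h] at hN hN'
  have hNn : denNat α (K + 1) ≤ N := by exact_mod_cast hN
  have hNn' : N < denNat α (K + 2) := by exact_mod_cast hN'
  have hN0 : 0 < N := lt_of_lt_of_le (den_mono_pos h K).2 hNn
  have hNr : (1 : ℝ) ≤ N := by exact_mod_cast hN0
  obtain ⟨-, -, hs⟩ := one_le_cfSum_succ h K
  have hmain := abs_le.1 (abs_sum_Ico_one_sub h K (L := N + 1) (by omega) hNn')
  have hIco : Finset.Ico 1 (N + 1) = Finset.Icc 1 N := rfl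
  rw [hIco, Nat.add_sub_cancel] at hmain
  push_cast at hmain
  rw [cfDen_eq h, cfQuot_succ h, Nat.floor_div_eq_div]
  have hl1 := log_succ_sub_le hN0
  have hl2 : Real.log N ≤ Real.log (N + 1) := Real.log_le_log (by linarith) (by linarith)
  have hl3 : 0 ≤ Real.log N := Real.log_natCast_nonneg N
  have hinv : 1 / (N : ℝ) ≤ 1 := by rw [div_le_one (by linarith)]; exact hNr
  have hl4 : Real.log (N + 1) ≤ N := by
    have := Real.log_le_sub_one_of_pos (x := (N : ℝ) + 1) (by linarith)
    linarith
  have hsq : Real.log (N + 1) ^ 2 - Real.log N ^ 2 ≤ 2 := by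
    have e : Real.log (N + 1) ^ 2 - Real.log N ^ 2 =
        (Real.log (N + 1) - Real.log N) * (Real.log (N + 1) + Real.log N) := by ring
    rw [e]
    calc _ ≤ 1 / (N : ℝ) * (N + N) := by gcongr <;> linarith
      _ = 2 := by field_simp; norm_num
  have hsq0 : 0 ≤ Real.log (N + 1) ^ 2 - Real.log N ^ 2 := by
    rw [sub_nonneg]; gcongr
  have hK := index_le_log h K hNn
  -- Only the sign of this part of the error is needed; the product of the two logarithms absorbs
  -- everything.
  have hsum : 0 ≤ ∑ k ∈ Finset.Icc 1 (K + 1), Real.sqrt (cfQuot α k) * errLog (cfQuot α k) :=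
    Finset.sum_nonneg fun k _ =>
      mul_nonneg (Real.sqrt_nonneg _) (zero_le_one.trans (one_le_errLog _))
  have e1 := one_le_errLog (cfSum α (K + 1))
  have e2 := log_le_errLog (show 0 < cfSum α (K + 1) by linarith)
  have e3 := one_le_errLog (N : ℝ)
  have e4 := log_le_errLog (show (0 : ℝ) < N by linarith)
  have hls := Real.log_nonneg hs
  set x := errLog (cfSum α (K + 1))
  set y := errLog (N : ℝ)
  have hxy : 1 ≤ x * y := one_le_mul_of_one_le_of_one_le e1 e3
  have hprod : (1 + Real.log (cfSum α (K + 1))) * (K + 1 + Real.log (N + 1)) ≤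
      2 * x * (7 * y) := by
    gcongr <;> linarith
  rw [abs_le]
  constructor <;> linarith
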